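/- Let $\mathbb{F}$ be an arbitrary field and let $\mathcal{D}=\bigoplus_{g}\mathcal{D}_g$ be a graded-division algebra over $\mathbb{F}$: a nonzero unital associative $\mathbb{F}$-algebra, of arbitrary dimension, graded by a group, in which every nonzero homogeneous element is invertible. Let $T$ be its support (a subgroup of the grading group) and let $\mathcal{D}^\times_{\mathrm{gr}}$ be the group of nonzero homogeneous elements. An involution of a graded algebra is an involutive $\mathbb{F}$-linear antiautomorphism mapping each homogeneous component into itself. An equivalence of graded algebras is an algebra isomorphism that maps each nonzero homogeneous component onto a homogeneous component; an equivalence of graded algebras with involution moreover intertwines the involutions. For $c\in\mathcal{D}^\times_{\mathrm{gr}}$ put $\mathrm{Int}(c)(x)=cxc^{-1}$. Let $\varphi_0$ be an involution of the graded algebra $\mathcal{D}$ (then $T$ is abelian), let $q,s\ge 0$ be integers, not both zero, let $\delta\in\{\pm1\}$, and let $\underline{d}=(d_1,\dots,d_q)$ with $0\ne d_i\in\mathcal{D}_{t_i}$ and $\varphi_0(d_i)=\delta d_i$ for all $i$. Put $k=q+2s$. Let $\widetilde G$ be the abelian group generated by $T$ and symbols $\tilde g_1,\dots,\tilde g_k$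 (that is, the quotient of $F\times T$, where $F$ is free abelian on the $\tilde g_i$) with the relations $$\tilde g_1^2t_1^{-1}=\dots=\tilde g_q^2t_q^{-1}=\tilde g_{q+1}\tilde g_{q+2}=\dots=\tilde g_{q+2s-1}\tilde g_{q+2s}.$$ Then $\mathcal{M}(\mathcal{D},\varphi_0,q,s,\underline{d},\delta)$ is the algebra $M_k(\mathcal{D})$ with the $\widetilde G$-grading given by $\deg(E_{ij}\otimes a)=\tilde g_i\tilde g_j^{-1}t$ for $0\neq a\in\mathcal{D}_t$, and with the involution $X\mapsto\Phi^{-1}\varphi_0(X^T)\Phi$ ($\varphi_0$ applied entrywise), where $$\Phi=\mathrm{diag}\left(d_1,\dots,d_q,\begin{bmatrix}0&1\\ \delta&0\end{bmatrix},\dots,\begin{bmatrix}0&1\\ \delta&0\end{bmatrix}\right)\quad (s\text{ blocks of size }2).$$ **Theorem.** Let $(\varphi_0,q,s,\underline{d},\delta)$ and $(\varphi_0',q',s',\underline{d}',\delta')$ be two sets of such data for the same $\mathcal{D}$. The graded algebras with involution $\mathcal{M}(\mathcal{D},\varphi_0,q,s,\underline{d},\delta)$ and $\mathcal{M}(\mathcal{D},\varphi_0',q',s',\underline{d}',\delta')$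 are equivalent if and only if $q'=q$, $s'=s$, and there exist an equivalence $\psi_0:\mathcal{D}\to\mathcal{D}$ of graded algebras and an element $c_0\in\mathcal{D}^\times_{\mathrm{gr}}$ such that 1. $\varphi_0'=\mathrm{Int}(c_0)\circ\psi_0\varphi_0\psi_0^{-1}$; 2. $\varphi_0'(c_0)=\delta\delta'c_0$; 3. there exist $c_1,\dots,c_q\in\mathcal{D}^\times_{\mathrm{gr}}$ such that $(d_1',\dots,d_q')$ is a permutation of $(\tilde d_1,\dots,\tilde d_q)$, where $\tilde d_i=c_0\,\psi_0\bigl(c_id_i\varphi_0(c_i)\bigr)$. -/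

import Mathlib

namespace GradedInv

section General

/-- An equivalence of graded algebras: an isomorphism of algebras that maps every nonzero
homogeneous component of the source onto a homogeneous component of the target. -/
def IsEquivalence {𝔽 A B ι κ : Type*} [Field 𝔽] [Ring A] [Algebra 𝔽 A] [Ring B] [Algebra 𝔽 B]
    (𝒜 : ι → Submodule 𝔽 A) (ℬ : κ → Submodule 𝔽 B) (ψ : A ≃ₐ[𝔽] B) : Prop :=
  ∀ i, 𝒜 i ≠ ⊥ → ∃ j, (𝒜 i).map ψ.toLinearMap = ℬ j

/-- A degree-preserving involution: an `𝔽`-linear involutive antiautomorphism that leaves every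
component of the family `𝒜` invariant. -/
structure GradedInvolution {𝔽 A ι : Type*} [Field 𝔽] [Ring A] [Algebra 𝔽 A]
    (𝒜 : ι → Submodule 𝔽 A) where
  toLinearMap : A →ₗ[𝔽] A
  map_mul' : ∀ a b, toLinearMap (a * b) = toLinearMap b * toLinearMap a
  involutive' : ∀ a, toLinearMap (toLinearMap a) = a
  map_mem' : ∀ i, ∀ a ∈ 𝒜 i, toLinearMap a ∈ 𝒜 i

instance {𝔽 A ι : Type*} [Field 𝔽] [Ring A] [Algebra 𝔽 A] (𝒜 : ι → Submodule 𝔽 A) :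
    CoeFun (GradedInvolution 𝒜) (fun _ => A → A) :=
  ⟨fun φ => φ.toLinearMap⟩

/-- Equivalence of graded algebras with involution. -/
def EquivalentWithInvolution {𝔽 A B ι κ : Type*} [Field 𝔽] [Ring A] [Algebra 𝔽 A] [Ring B]
    [Algebra 𝔽 B] {𝒜 : ι → Submodule 𝔽 A} {ℬ : κ → Submodule 𝔽 B}
    (φ : GradedInvolution 𝒜) (φ' : GradedInvolution ℬ) : Prop :=
  ∃ ψ : A ≃ₐ[𝔽] B, IsEquivalence 𝒜 ℬ ψ ∧ ∀ a, ψ (φ a) = φ' (ψ a)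

end General

section GradedDivision

variable {𝔽 D G : Type*} [Field 𝔽] [Ring D] [Algebra 𝔽 D] [AddGroup G] [DecidableEq G]

/-- A graded-division algebra: a nonzero unital algebra, graded by a group (written additively,
not necessarily commutative), in which all nonzero homogeneous elements are invertible. -/
class IsGradedDivision (𝒟 : G → Submodule 𝔽 D) [GradedAlgebra 𝒟] : Prop where
  nontrivial : Nontrivial D
  isUnit : ∀ g, ∀ x ∈ 𝒟 g, x ≠ 0 → IsUnit x

/-- The nonzero homogeneous elements of a graded-division algebra, as a set of units. -/
def homogeneousUnits (𝒟 : G → Submodule 𝔽 D) : Set Dˣ :=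
  {c | ∃ g, (c : D) ∈ 𝒟 g}

theorem inv_mem (𝒟 : G → Submodule 𝔽 D) [GradedAlgebra 𝒟] {g : G} {u : Dˣ}
    (hu : (u : D) ∈ 𝒟 g) : ((u⁻¹ : Dˣ) : D) ∈ 𝒟 (-g) := by
  have h := DirectSum.coe_decompose_mul_add_of_left_mem 𝒟 (j := -g) (b := ((u⁻¹ : Dˣ) : D)) hu
  rw [add_neg_cancel, Units.mul_inv,
    DirectSum.decompose_of_mem_same 𝒟 (SetLike.one_mem_graded 𝒟)] at h
  rw [Units.inv_eq_of_mul_eq_one_right h.symm]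
  exact SetLike.coe_mem _

/-- The support of a graded-division algebra, which is a subgroup of the grading group. -/
def supportSubgroup (𝒟 : G → Submodule 𝔽 D) [GradedAlgebra 𝒟] [IsGradedDivision 𝒟] :
    AddSubgroup G where
  carrier := {g | 𝒟 g ≠ ⊥}
  zero_mem' := by
    have := IsGradedDivision.nontrivial (𝒟 := 𝒟)
    exact (Submodule.ne_bot_iff _).2 ⟨1, SetLike.one_mem_graded 𝒟, one_ne_zero⟩
  add_mem' := by
    intro a b ha hb
    obtain ⟨x, hx, hx0⟩ := (Submodule.ne_bot_iff _).1 ha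
    obtain ⟨y, hy, hy0⟩ := (Submodule.ne_bot_iff _).1 hb
    refine (Submodule.ne_bot_iff _).2 ⟨x * y, SetLike.mul_mem_graded hx hy, ?_⟩
    rwa [Ne, (IsGradedDivision.isUnit a x hx hx0).mul_right_eq_zero]
  neg_mem' := by
    intro a ha
    have := IsGradedDivision.nontrivial (𝒟 := 𝒟)
    obtain ⟨x, hx, hx0⟩ := (Submodule.ne_bot_iff _).1 ha
    obtain ⟨u, rfl⟩ := IsGradedDivision.isUnit a x hx hx0
    exact (Submodule.ne_bot_iff _).2 ⟨_, inv_mem 𝒟 hx, Units.ne_zero _⟩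

/-- In the presence of a degree-preserving involution the support is commutative. -/
theorem support_add_comm {𝒟 : G → Submodule 𝔽 D} [GradedAlgebra 𝒟] [IsGradedDivision 𝒟]
    (φ : GradedInvolution 𝒟) (a b : supportSubgroup 𝒟) : a + b = b + a := by
  obtain ⟨a, ha⟩ := a
  obtain ⟨b, hb⟩ := b
  obtain ⟨x, hx, hx0⟩ := (Submodule.ne_bot_iff _).1 ha
  obtain ⟨y, hy, hy0⟩ := (Submodule.ne_bot_iff _).1 hb
  have h1 : φ (x * y) ∈ 𝒟 (a + b) := φ.map_mem' _ _ (SetLike.mul_mem_graded hx hy)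
  have h2 : φ (x * y) ∈ 𝒟 (b + a) := by
    rw [φ.map_mul']
    exact SetLike.mul_mem_graded (φ.map_mem' _ _ hy) (φ.map_mem' _ _ hx)
  have h0 : φ (x * y) ≠ 0 := by
    intro h
    have h3 := φ.involutive' (x * y)
    rw [h, map_zero] at h3
    exact hy0 ((IsGradedDivision.isUnit a x hx hx0).mul_right_eq_zero.1 h3.symm)
  exact Subtype.ext (DirectSum.degree_eq_of_mem_mem 𝒟 h1 h2 h0)

end GradedDivision

section GradingGroup

/-- The index set `{1, …, q + 2s}`: first `q` indices, followed by `s` pairs, where `(0, j)` and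
`(1, j)` stand for `q + 2j - 1` and `q + 2j`. -/
abbrev Idx (q s : ℕ) : Type := Fin q ⊕ (Fin 2 × Fin s)

/-- The elements of `F × T`, with `F` the free abelian group on the symbols `g̃ᵢ`, that become
equal in `G̃(T, q, s, t)`; additively, `2 g̃ᵢ - tᵢ` and `g̃_{(0,j)} + g̃_{(1,j)}`. -/
noncomputable def relator {T : Type*} [AddCommGroup T] {q : ℕ} (s : ℕ) (t : Fin q → T) :
    Fin q ⊕ Fin s → (Idx q s →₀ ℤ) × T
  | .inl i => (Finsupp.single (.inl i) 2, - t i)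
  | .inr j => (Finsupp.single (.inr (0, j)) 1 + Finsupp.single (.inr (1, j)) 1, 0)

/-- The abelian group `G̃(T, q, s, t)`, written additively. -/
abbrev GTilde {T : Type*} [AddCommGroup T] {q : ℕ} (s : ℕ) (t : Fin q → T) : Type _ :=
  ((Idx q s →₀ ℤ) × T) ⧸
    AddSubgroup.closure {r | ∃ a b, r = relator s t a - relator s t b}

/-- The image of the generator `g̃ᵢ` in `G̃(T, q, s, t)`. -/
noncomputable def GTilde.gen {T : Type*} [AddCommGroup T] {q : ℕ} (s : ℕ) (t : Fin q → T)
    (i : Idx q s) : GTilde s t :=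
  QuotientAddGroup.mk (Finsupp.single i 1, 0)

/-- The canonical map from `T` to `G̃(T, q, s, t)`. -/
noncomputable def GTilde.ofT {T : Type*} [AddCommGroup T] {q : ℕ} (s : ℕ) (t : Fin q → T) :
    T →+ GTilde s t :=
  (QuotientAddGroup.mk' _).comp (AddMonoidHom.inr _ _)

end GradingGroup

section Construction

variable {𝔽 D G : Type*} [Field 𝔽] [Ring D] [Algebra 𝔽 D]

/-- The data `(φ₀, q, s, d, δ)` from which `ℳ(𝒟, φ₀, q, s, d, δ)` is built, with `tᵢ` the degree
of `dᵢ`. -/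
structure Params (𝒟 : G → Submodule 𝔽 D) where
  φ₀ : GradedInvolution 𝒟
  q : ℕ
  s : ℕ
  pos : 0 < q + s
  δ : 𝔽
  hδ : δ = 1 ∨ δ = -1
  t : Fin q → G
  d : Fin q → D
  d_mem : ∀ i, d i ∈ 𝒟 (t i)
  d_ne : ∀ i, d i ≠ 0
  d_symm : ∀ i, φ₀ (d i) = δ • d i

namespace Params

theorem δ_mul_δ {𝒟 : G → Submodule 𝔽 D} (P : Params 𝒟) : P.δ * P.δ = 1 := by
  rcases P.hδ with h | h <;> simp [h]

/-- The underlying algebra `M_k(𝒟)`, `k = q + 2s`. -/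
abbrev Alg {𝒟 : G → Submodule 𝔽 D} (P : Params 𝒟) : Type _ :=
  Matrix (Idx P.q P.s) (Idx P.q P.s) D

/-- The entrywise application of `φ₀` to the transpose of a matrix: `X ↦ φ₀(Xᵀ)`. -/
def conjT {𝒟 : G → Submodule 𝔽 D} (P : Params 𝒟) (X : P.Alg) : P.Alg :=
  X.transpose.map P.φ₀

theorem conjT_mul {𝒟 : G → Submodule 𝔽 D} (P : Params 𝒟) (X Y : P.Alg) :
    P.conjT (X * Y) = P.conjT Y * P.conjT X := by
  ext i j
  simp [conjT, Matrix.mul_apply, map_sum, P.φ₀.map_mul']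

theorem conjT_conjT {𝒟 : G → Submodule 𝔽 D} (P : Params 𝒟) (X : P.Alg) :
    P.conjT (P.conjT X) = X := by
  ext i j
  simp [conjT, P.φ₀.involutive']

theorem φ₀_one {𝒟 : G → Submodule 𝔽 D} (P : Params 𝒟) : P.φ₀ 1 = 1 := by
  have h := P.φ₀.map_mul' (P.φ₀ 1) 1
  rw [mul_one, P.φ₀.involutive', mul_one] at h
  exact h.symm

variable [AddGroup G] [DecidableEq G] {𝒟 : G → Submodule 𝔽 D} [GradedAlgebra 𝒟]
  [IsGradedDivision 𝒟]

/-- The support `T` of `𝒟`, as an abelian group. -/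
def T (_P : Params 𝒟) : Type _ := supportSubgroup 𝒟

variable (P : Params 𝒟)

instance : AddCommGroup P.T :=
  { (inferInstance : AddGroup (supportSubgroup 𝒟)) with add_comm := support_add_comm P.φ₀ }

/-- The component of degree `t ∈ T` of `𝒟`. -/
def compD (t : P.T) : Submodule 𝔽 D := 𝒟 (show supportSubgroup 𝒟 from t).1

theorem mul_mem_compD {t u : P.T} {a b : D} (ha : a ∈ P.compD t) (hb : b ∈ P.compD u) :
    a * b ∈ P.compD (t + u) :=
  SetLike.mul_mem_graded (A := 𝒟) ha hb

/-- The degree of `dᵢ` as an element of the support. -/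
def deg (i : Fin P.q) : P.T :=
  (⟨P.t i, (Submodule.ne_bot_iff _).2 ⟨P.d i, P.d_mem i, P.d_ne i⟩⟩ : supportSubgroup 𝒟)

/-- The grading group `G̃(T, q, s, t)`. -/
abbrev Gt : Type _ := GTilde P.s P.deg

/-- The grading of `M_k(𝒟)` by `deg (E_{ij} ⊗ a) = g̃ᵢ - g̃ⱼ + t` for `a ∈ 𝒟_t`. -/
def comp (g : P.Gt) : Submodule 𝔽 P.Alg :=
  Submodule.span 𝔽 {X | ∃ (i j : Idx P.q P.s) (t : P.T), ∃ a ∈ P.compD t,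
    GTilde.gen P.s P.deg i - GTilde.gen P.s P.deg j + GTilde.ofT P.s P.deg t = g ∧
      X = Matrix.single i j a}

/-- The element `dᵢ` as a unit. -/
noncomputable def dUnit (i : Fin P.q) : Dˣ :=
  (IsGradedDivision.isUnit (𝒟 := 𝒟) (P.t i) (P.d i) (P.d_mem i) (P.d_ne i)).unit

theorem coe_dUnit (i : Fin P.q) : (P.dUnit i : D) = P.d i := rfl

/-- The matrix `Φ = diag(d₁, …, d_q, [0 1; δ 0], …, [0 1; δ 0])`, as an invertible matrix. -/
noncomputable def Phi : P.Algˣ where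
  val := Matrix.fromBlocks (Matrix.diagonal P.d) 0 0
    (Matrix.blockDiagonal fun _ : Fin P.s => !![0, 1; algebraMap 𝔽 D P.δ, 0])
  inv := Matrix.fromBlocks (Matrix.diagonal fun i => (((P.dUnit i)⁻¹ : Dˣ) : D)) 0 0
    (Matrix.blockDiagonal fun _ : Fin P.s => !![0, algebraMap 𝔽 D P.δ; 1, 0])
  val_inv := by
    have h : (!![0, 1; algebraMap 𝔽 D P.δ, 0] : Matrix (Fin 2) (Fin 2) D) *
        !![0, algebraMap 𝔽 D P.δ; 1, 0] = 1 := by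
      ext a b
      fin_cases a <;> fin_cases b <;> simp [Matrix.mul_apply, ← map_mul, P.δ_mul_δ]
    rw [Matrix.fromBlocks_multiply, ← Matrix.blockDiagonal_mul, Matrix.diagonal_mul_diagonal, h]
    have h1 : (Matrix.blockDiagonal fun _ : Fin P.s => (1 : Matrix (Fin 2) (Fin 2) D)) = 1 :=
      Matrix.blockDiagonal_one
    simp [← P.coe_dUnit, h1]
  inv_val := by
    have h : (!![0, algebraMap 𝔽 D P.δ; 1, 0] : Matrix (Fin 2) (Fin 2) D) *
        !![0, 1; algebraMap 𝔽 D P.δ, 0] = 1 := by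
      ext a b
      fin_cases a <;> fin_cases b <;> simp [Matrix.mul_apply, ← map_mul, P.δ_mul_δ]
    rw [Matrix.fromBlocks_multiply, ← Matrix.blockDiagonal_mul, Matrix.diagonal_mul_diagonal, h]
    have h1 : (Matrix.blockDiagonal fun _ : Fin P.s => (1 : Matrix (Fin 2) (Fin 2) D)) = 1 :=
      Matrix.blockDiagonal_one
    simp [← P.coe_dUnit, h1]

theorem conjT_Phi : P.conjT (P.Phi : P.Alg) = P.δ • (P.Phi : P.Alg) := by
  have h1 := P.φ₀_one
  have h2 := P.δ_mul_δ
  ext i j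
  rcases i with i | ⟨a, i⟩ <;> rcases j with j | ⟨b, j⟩
  · by_cases h : i = j
    · subst h
      simp [conjT, Phi, P.d_symm]
    · simp [conjT, Phi, h, Ne.symm h]
  · simp [conjT, Phi]
  · simp [conjT, Phi]
  · by_cases h : i = j
    · subst h
      fin_cases a <;> fin_cases b <;>
        simp [conjT, Phi, Matrix.blockDiagonal_apply, h1, Algebra.algebraMap_eq_smul_one,
          smul_smul, h2]
    · simp [conjT, Phi, Matrix.blockDiagonal_apply, h, Ne.symm h]

/-- The map `X ↦ Φ⁻¹ φ₀(Xᵀ) Φ` on `M_k(𝒟)`. -/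
noncomputable def adj (X : P.Alg) : P.Alg :=
  ((P.Phi⁻¹ : P.Algˣ) : P.Alg) * P.conjT X * (P.Phi : P.Alg)

theorem adj_mul (X Y : P.Alg) : P.adj (X * Y) = P.adj Y * P.adj X := by
  simp [adj, conjT_mul, mul_assoc]

theorem conjT_Phi_inv :
    P.conjT ((P.Phi⁻¹ : P.Algˣ) : P.Alg) = P.δ • ((P.Phi⁻¹ : P.Algˣ) : P.Alg) := by
  have h1 : P.conjT (1 : P.Alg) = 1 := by
    ext i j
    by_cases h : i = j
    · subst h; simp [conjT, P.φ₀_one]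
    · simp [conjT, h]
  have h2 : P.conjT ((P.Phi⁻¹ : P.Algˣ) : P.Alg) * (P.δ • (P.Phi : P.Alg)) = 1 := by
    have h := P.conjT_mul (P.Phi : P.Alg) ((P.Phi⁻¹ : P.Algˣ) : P.Alg)
    rw [Units.mul_inv, h1, conjT_Phi] at h
    exact h.symm
  calc P.conjT ((P.Phi⁻¹ : P.Algˣ) : P.Alg)
      = P.conjT ((P.Phi⁻¹ : P.Algˣ) : P.Alg) * (P.δ • (P.Phi : P.Alg)) *
          (P.δ • ((P.Phi⁻¹ : P.Algˣ) : P.Alg)) := by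
        simp [mul_assoc, smul_smul, P.δ_mul_δ]
    _ = _ := by rw [h2, one_mul]

theorem adj_adj (X : P.Alg) : P.adj (P.adj X) = X := by
  simp [adj, conjT_mul, conjT_conjT, conjT_Phi, conjT_Phi_inv, mul_assoc, smul_smul, P.δ_mul_δ]

theorem mk_relator (a b : Fin P.q ⊕ Fin P.s) :
    (QuotientAddGroup.mk (relator P.s P.deg a) : P.Gt) =
      QuotientAddGroup.mk (relator P.s P.deg b) := by
  rw [eq_comm, QuotientAddGroup.eq]
  refine AddSubgroup.subset_closure ⟨a, b, ?_⟩
  rw [neg_add_eq_sub]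

theorem gen_inl (i : Fin P.q) :
    GTilde.gen P.s P.deg (.inl i) + GTilde.gen P.s P.deg (.inl i) - GTilde.ofT P.s P.deg (P.deg i) =
      QuotientAddGroup.mk (relator P.s P.deg (.inl i)) := by
  simp only [GTilde.gen, GTilde.ofT, AddMonoidHom.comp_apply, QuotientAddGroup.mk'_apply,
    ← QuotientAddGroup.mk_add, ← QuotientAddGroup.mk_sub]
  congr 1
  ext1 <;> simp [relator, ← Finsupp.single_add]

theorem gen_inr (j : Fin P.s) :
    GTilde.gen P.s P.deg (.inr (0, j)) + GTilde.gen P.s P.deg (.inr (1, j)) -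
        GTilde.ofT P.s P.deg 0 =
      QuotientAddGroup.mk (relator P.s P.deg (.inr j)) := by
  simp only [GTilde.gen, map_zero, sub_zero, ← QuotientAddGroup.mk_add]
  congr 1
  ext1 <;> simp [relator]

theorem Phi_mem (i m : Idx P.q P.s) : (P.Phi : P.Alg) i m = 0 ∨ ∃ (u : P.T) (a : _),
    (P.Phi : P.Alg) i m ∈ P.compD u ∧
      GTilde.gen P.s P.deg i + GTilde.gen P.s P.deg m - GTilde.ofT P.s P.deg u =
        QuotientAddGroup.mk (relator P.s P.deg a) := by
  have hd : ∀ i, P.d i ∈ P.compD (P.deg i) := P.d_mem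
  have h0 : (1 : D) ∈ P.compD 0 := SetLike.one_mem_graded 𝒟
  have hδ : algebraMap 𝔽 D P.δ ∈ P.compD 0 := by
    rw [Algebra.algebraMap_eq_smul_one]
    exact Submodule.smul_mem _ _ h0
  rcases i with i | ⟨a, i⟩ <;> rcases m with m | ⟨b, m⟩
  · by_cases h : i = m
    · subst h
      exact .inr ⟨P.deg i, .inl i, by simpa [Phi] using hd i, P.gen_inl i⟩
    · simp [Phi, h]
  · simp [Phi]
  · simp [Phi]
  · by_cases h : i = m
    · subst h
      fin_cases a <;> fin_cases b
      · simp [Phi, Matrix.blockDiagonal_apply]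
      · exact .inr ⟨0, .inr i, by simpa [Phi, Matrix.blockDiagonal_apply] using h0, P.gen_inr i⟩
      · exact .inr ⟨0, .inr i, by simpa [Phi, Matrix.blockDiagonal_apply] using hδ,
          by rw [← P.gen_inr i, add_comm (GTilde.gen P.s P.deg _)]; rfl⟩
      · simp [Phi, Matrix.blockDiagonal_apply]
    · simp [Phi, Matrix.blockDiagonal_apply, h]

theorem Phi_inv_mem (i m : Idx P.q P.s) : ((P.Phi⁻¹ : P.Algˣ) : P.Alg) i m = 0 ∨
    ∃ (u : P.T) (a : _), ((P.Phi⁻¹ : P.Algˣ) : P.Alg) i m ∈ P.compD (-u) ∧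
      GTilde.gen P.s P.deg i + GTilde.gen P.s P.deg m - GTilde.ofT P.s P.deg u =
        QuotientAddGroup.mk (relator P.s P.deg a) := by
  have h0 : (1 : D) ∈ P.compD (-0) := by rw [neg_zero]; exact SetLike.one_mem_graded 𝒟
  have hδ : algebraMap 𝔽 D P.δ ∈ P.compD (-0) := by
    rw [Algebra.algebraMap_eq_smul_one]
    exact Submodule.smul_mem _ _ h0
  change P.Phi.inv i m = 0 ∨ ∃ (u : P.T) (a : _), P.Phi.inv i m ∈ P.compD (-u) ∧ _
  rcases i with i | ⟨a, i⟩ <;> rcases m with m | ⟨b, m⟩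
  · by_cases h : i = m
    · subst h
      refine .inr ⟨P.deg i, .inl i, ?_, P.gen_inl i⟩
      have h2 : (((P.dUnit i)⁻¹ : Dˣ) : D) ∈ P.compD (-P.deg i) :=
        inv_mem 𝒟 (u := P.dUnit i) (P.d_mem i)
      simpa [Phi] using h2
    · simp [Phi, h]
  · simp [Phi]
  · simp [Phi]
  · by_cases h : i = m
    · subst h
      fin_cases a <;> fin_cases b
      · simp [Phi, Matrix.blockDiagonal_apply]
      · exact .inr ⟨0, .inr i, by simpa [Phi, Matrix.blockDiagonal_apply] using hδ, P.gen_inr i⟩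
      · exact .inr ⟨0, .inr i, by simpa [Phi, Matrix.blockDiagonal_apply] using h0,
          by rw [← P.gen_inr i, add_comm (GTilde.gen P.s P.deg _)]; rfl⟩
      · simp [Phi, Matrix.blockDiagonal_apply]
    · simp [Phi, Matrix.blockDiagonal_apply, h]

/-- `X ↦ Φ⁻¹ φ₀(Xᵀ) Φ` as a linear map. -/
noncomputable def adjLin : P.Alg →ₗ[𝔽] P.Alg where
  toFun := P.adj
  map_add' := by
    intro X Y
    have h : P.conjT (X + Y) = P.conjT X + P.conjT Y := by ext; simp [conjT]
    simp [adj, h, mul_add, add_mul]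
  map_smul' := by
    intro c X
    have h : P.conjT (c • X) = c • P.conjT X := by ext; simp [conjT]
    simp [adj, h]

theorem adj_mem (g : P.Gt) (X : P.Alg) (hX : X ∈ P.comp g) : P.adj X ∈ P.comp g := by
  suffices h : P.comp g ≤ (P.comp g).comap P.adjLin from h hX
  refine Submodule.span_le.2 ?_
  rintro _ ⟨i, j, t, a, ha, hg, rfl⟩
  change P.adj _ ∈ P.comp g
  have hc : P.conjT (Matrix.single i j a) = Matrix.single j i (P.φ₀ a) := by
    ext k l
    simp only [conjT, Matrix.map_apply, Matrix.transpose_apply, Matrix.single_apply, and_comm]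
    split_ifs <;> simp
  rw [Matrix.matrix_eq_sum_single (P.adj _)]
  refine Submodule.sum_mem _ fun l _ => Submodule.sum_mem _ fun m _ => ?_
  have he : P.adj (Matrix.single i j a) l m =
      ((P.Phi⁻¹ : P.Algˣ) : P.Alg) l j * P.φ₀ a * (P.Phi : P.Alg) i m := by
    rw [adj, hc, Matrix.mul_apply, Finset.sum_eq_single i]
    · simp
    · intro k _ hk
      rw [Matrix.mul_single_apply_of_ne _ _ _ _ _ hk, zero_mul]
    · simp
  rw [he]
  rcases P.Phi_mem i m with h1 | ⟨u, b, h1, h2⟩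
  · simp [h1]
  rcases P.Phi_inv_mem l j with h3 | ⟨v, c, h3, h4⟩
  · simp [h3]
  refine Submodule.subset_span ⟨l, m, -v + t + u, _, ?_, ?_, rfl⟩
  · exact P.mul_mem_compD (P.mul_mem_compD h3 (P.φ₀.map_mem' _ _ ha)) h1
  · have h5 := h4.trans ((P.mk_relator c b).trans h2.symm)
    rw [← hg, map_add, map_add, map_neg]
    rw [sub_eq_sub_iff_add_eq_add] at h5
    rw [← sub_eq_zero] at h5 ⊢
    rw [← h5]
    abel

/-- The involution `X ↦ Φ⁻¹ φ₀(Xᵀ) Φ` of the graded algebra `M_k(𝒟)`; thus this is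
`ℳ(𝒟, φ₀, q, s, d, δ)`. -/
noncomputable def involution : GradedInvolution P.comp where
  toLinearMap := P.adjLin
  map_mul' := P.adj_mul
  involutive' := P.adj_adj
  map_mem' := P.adj_mem

end Params

end Construction

end GradedInv

/-!
The differences `g̃ᵢ - g̃ⱼ` with `i ≠ j` do not lie in `T`, and `T` embeds in `G̃`
(`GTilde.gen_sub_gen_add_ofT_eq_zero`). Hence the component of degree zero of `M_k(𝒟)` consists of
the diagonal matrices over the division algebra `𝒟_0`, and its minimal idempotents are the diagonal
matrix units `E_{ii}`. An equivalence `ψ` preserves the component of degree zero, because it fixes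
the identity, so it permutes the `E_{ii}` by some bijection `σ` (`Params.exists_perm`).

Write `fᵢ` for the only nonzero entry of `Φ` in row `i` and `star i` for its column. The involution
sends `E_{ij} ⊗ a` to `E_{star j, star i} ⊗ fⱼ⁻¹ φ₀(a) fᵢ` (`Params.involution_single`). It permutes
the `E_{ii}` through `star`, so `σ` commutes with `star`; counting the fixed points of `star` and all
indices gives `q' = q` and `s' = s`.

On the other hand `ψ (E_{ij} ⊗ a) = E_{σ i, σ j} ⊗ uᵢ ψ₀(a) uⱼ⁻¹`, where `ψ₀` is the restriction of
`ψ` to one corner `E_{oo} ⊗ 𝒟` and the `uᵢ` are homogeneous units (`map_single_eq`). With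
`cᵢ = φ₀'(uᵢ) f'_{σ i} u_{star i} ψ₀(fᵢ)⁻¹`, such a map intertwines the involutions if and only if
`cⱼ ψ₀(φ₀(a)) = φ₀'(ψ₀(a)) cᵢ` for all `i`, `j`, `a` (`intertwine_iff`). Taking `a = 1`, all `cᵢ` are
equal to one element `c₀`, and the condition says that `φ₀' = Int(c₀) ψ₀ φ₀ ψ₀⁻¹`. The equations
`c₀ ψ₀(fᵢ) = φ₀'(uᵢ) f'_{σ i} u_{star i}` for `i ≤ q` express the `d'` through the `d`, and applying
`φ₀'` to one of them gives `φ₀'(c₀) = δ δ' c₀`.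

Conversely, given `ψ₀`, `c₀` and now homogeneous units `cᵢ` with `d'` a permutation of the elements
`c₀ ψ₀(cᵢ dᵢ φ₀(cᵢ))`, these equations are solved by `uᵢ = ψ₀(φ₀(cᵢ))⁻¹` for `i ≤ q` and
by `1`, `c₀` on the pairs, which yields a monomial isomorphism compatible with the involutions.
Comparing degrees in the same equations shows that the assignment
`g̃ᵢ ↦ g̃_{σ i} + deg uᵢ` respects the relations of `G̃` up to the common shift by `deg c₀`, so it
defines a homomorphism of grading groups; the inverse monomial isomorphism defines its inverse on
degrees, and the isomorphism is an equivalence (`Params.monomialEquiv_isEquivalence`).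
-/

namespace GradedInv

/-! ### The grading group -/

/-- The pairing of the index set `{1, …, q + 2s}`: it fixes the first `q` indices and exchanges
the two members of each of the `s` pairs. -/
def star {q s : ℕ} : Idx q s → Idx q s
  | .inl i => .inl i
  | .inr (a, j) => .inr (a.rev, j)

theorem star_star {q s : ℕ} (i : Idx q s) : star (star i) = i := by
  rcases i with i | ⟨a, j⟩ <;> simp [star]

theorem star_eq_self_iff {q s : ℕ} (i : Idx q s) : star i = i ↔ ∃ k, i = .inl k := by
  rcases i with i | ⟨a, j⟩
  · simp [star]
  · fin_cases a <;> simp [star]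

namespace GTilde

variable {T : Type*} [AddCommGroup T] {q : ℕ} (s : ℕ) (t : Fin q → T)

/-- The family `t` extended by zero to all indices. In `G̃` the element
`g̃ᵢ + g̃_{star i} - pairDeg t i` does not depend on `i`. -/
def pairDeg : Idx q s → T
  | .inl i => t i
  | .inr _ => 0

theorem exists_of_mem_closure {x : (Idx q s →₀ ℤ) × T}
    (hx : x ∈ AddSubgroup.closure {r | ∃ a b, r = relator s t a - relator s t b}) :
    ∃ n : Fin q ⊕ Fin s → ℤ, x = ∑ a, n a • relator s t a := by
  induction hx using AddSubgroup.closure_induction with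
  | mem x hx =>
    obtain ⟨a, b, rfl⟩ := hx
    refine ⟨Pi.single a 1 - Pi.single b 1, ?_⟩
    simp [sub_smul, Finset.sum_sub_distrib, Pi.single_apply, ite_smul]
  | zero => exact ⟨0, by simp⟩
  | add x y _ _ hx hy =>
    obtain ⟨n, rfl⟩ := hx
    obtain ⟨m, rfl⟩ := hy
    exact ⟨n + m, by simp [add_smul, Finset.sum_add_distrib]⟩
  | neg x _ hx =>
    obtain ⟨n, rfl⟩ := hx
    exact ⟨-n, by simp⟩

theorem sum_relator_fst_inl (n : Fin q ⊕ Fin s → ℤ) (i : Fin q) :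
    (∑ a, n a • relator s t a).1 (.inl i) = 2 * n (.inl i) := by
  simp [relator, Prod.fst_sum, Finsupp.single_apply, mul_comm]

theorem sum_relator_fst_inr (n : Fin q ⊕ Fin s → ℤ) (b : Fin 2) (j : Fin s) :
    (∑ a, n a • relator s t a).1 (.inr (b, j)) = n (.inr j) := by
  fin_cases b <;>
  simp [relator, Prod.fst_sum, Finsupp.single_apply]

theorem gen_sub_gen_add_ofT (i j : Idx q s) (u : T) :
    gen s t i - gen s t j + ofT s t u =
      QuotientAddGroup.mk (Finsupp.single i 1 - Finsupp.single j 1, u) := by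
  simp only [gen, ofT, AddMonoidHom.comp_apply, QuotientAddGroup.mk'_apply,
    ← QuotientAddGroup.mk_add, ← QuotientAddGroup.mk_sub]
  congr 1
  ext1 <;> simp

/-- The differences `g̃ᵢ - g̃ⱼ` with `i ≠ j` do not lie in `T`, and `T` embeds in `G̃`. -/
theorem gen_sub_gen_add_ofT_eq_zero {i j : Idx q s} {u : T}
    (h : gen s t i - gen s t j + ofT s t u = 0) : i = j ∧ u = 0 := by
  rw [gen_sub_gen_add_ofT, QuotientAddGroup.eq_zero_iff] at h
  obtain ⟨n, hn⟩ := exists_of_mem_closure s t h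
  have h1 : Finsupp.single i 1 - Finsupp.single j 1 = (∑ a, n a • relator s t a).1 :=
    congrArg Prod.fst hn
  have hij : i = j := by
    by_contra hij
    have hi := DFunLike.congr_fun h1 i
    rcases i with i | ⟨a, i⟩
    · rw [sum_relator_fst_inl] at hi
      simp [Ne.symm hij] at hi
      omega
    · have hi' := DFunLike.congr_fun h1 (.inr (a.rev, i))
      rw [sum_relator_fst_inr] at hi hi'
      have ha : a ≠ a.rev := by fin_cases a <;> simp
      simp only [Finsupp.sub_apply, Finsupp.single_apply, Ne.symm hij, if_true, if_false,
        Sum.inr.injEq, Prod.mk.injEq, ha, false_and] at hi hi'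
      split_ifs at hi' <;> omega
  refine ⟨hij, ?_⟩
  subst hij
  have h0 : n = 0 := by
    funext a
    rcases a with a | a
    · have := DFunLike.congr_fun h1 (.inl a)
      rw [sum_relator_fst_inl] at this
      simpa using this.symm
    · have := DFunLike.congr_fun h1 (.inr (0, a))
      rw [sum_relator_fst_inr] at this
      simpa using this.symm
  simpa [h0] using congrArg Prod.snd hn

theorem ofT_injective : Function.Injective (ofT s t) := by
  refine (injective_iff_map_eq_zero _).2 fun u hu => ?_
  by_cases hI : Nonempty (Idx q s)
  · obtain ⟨i⟩ := hI
    exact (gen_sub_gen_add_ofT_eq_zero s t (i := i) (j := i) (by simpa using hu)).2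
  · have : IsEmpty (Idx q s) := not_nonempty_iff.1 hI
    have : IsEmpty (Fin q ⊕ Fin s) :=
      ⟨fun a => a.elim (fun i => IsEmpty.false (Sum.inl i : Idx q s))
        fun j => IsEmpty.false (Sum.inr (0, j) : Idx q s)⟩
    obtain ⟨n, hn⟩ := exists_of_mem_closure s t ((QuotientAddGroup.eq_zero_iff _).1 hu)
    simpa using congrArg Prod.snd hn

theorem gen_add_gen_star (i : Idx q s) : ∃ a : Fin q ⊕ Fin s,
      gen s t i + gen s t (star i) - ofT s t (pairDeg s t i) =
    QuotientAddGroup.mk (relator s t a) := by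
  simp only [gen, ofT, AddMonoidHom.comp_apply, QuotientAddGroup.mk'_apply,
    ← QuotientAddGroup.mk_add, ← QuotientAddGroup.mk_sub]
  rcases i with i | ⟨b, i⟩
  · refine ⟨.inl i, congrArg _ ?_⟩
    ext1 <;> simp [relator, star, pairDeg, ← Finsupp.single_add]
  · refine ⟨.inr i, congrArg _ ?_⟩
    fin_cases b <;> ext1 <;> simp [relator, star, pairDeg, add_comm]

theorem gen_add_gen_star_eq (i j : Idx q s) :
    gen s t i + gen s t (star i) - ofT s t (pairDeg s t i) =
      gen s t j + gen s t (star j) - ofT s t (pairDeg s t j) := by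
  obtain ⟨a, ha⟩ := gen_add_gen_star s t i
  obtain ⟨b, hb⟩ := gen_add_gen_star s t j
  rw [ha, hb, eq_comm, QuotientAddGroup.eq]
  exact AddSubgroup.subset_closure ⟨a, b, (neg_add_eq_sub _ _)⟩

/-- The universal property of `G̃`. -/
theorem exists_hom {A : Type*} [AddCommGroup A] (γ : Idx q s → A) (τ : T →+ A)
    (h : ∀ i j, γ i + γ (star i) - τ (pairDeg s t i) =
      γ j + γ (star j) - τ (pairDeg s t j)) :
    ∃ α : GTilde s t →+ A, (∀ i, α (gen s t i) = γ i) ∧ ∀ u, α (ofT s t u) = τ u := by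
  let f : (Idx q s →₀ ℤ) × T →+ A :=
    AddMonoidHom.coprod (Finsupp.liftAddHom fun i => zmultiplesHom A (γ i)) τ
  have hf : ∀ a, ∃ i, f (relator s t a) = γ i + γ (star i) - τ (pairDeg s t i) := by
    rintro (a | a)
    · exact ⟨.inl a, by simp [f, relator, star, pairDeg, two_smul, sub_eq_add_neg]⟩
    · exact ⟨.inr (0, a), by simp [f, relator, star, pairDeg]⟩
  refine ⟨QuotientAddGroup.lift _ f ?_, ?_, ?_⟩
  · refine (AddSubgroup.closure_le _).2 ?_
    rintro _ ⟨a, b, rfl⟩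
    obtain ⟨i, hi⟩ := hf a
    obtain ⟨j, hj⟩ := hf b
    change f _ = 0
    rw [map_sub, hi, hj, h i j, sub_self]
  · intro i
    simp [gen, f]
  · intro u
    simp [ofT, f]

end GTilde

/-! ### Homogeneous units and antiautomorphisms -/

section Homogeneous

variable {𝔽 D G : Type*} [Field 𝔽] [Ring D] [Algebra 𝔽 D]

theorem GradedInvolution.map_one' {𝒟 : G → Submodule 𝔽 D} (φ : GradedInvolution 𝒟) :
    φ 1 = 1 := by
  have h := φ.map_mul' (φ 1) 1
  rw [mul_one, φ.involutive', mul_one] at h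
  exact h.symm

theorem Params.nonempty_idx {𝒟 : G → Submodule 𝔽 D} (P : Params 𝒟) : Nonempty (Idx P.q P.s) := by
  by_cases h : 0 < P.q
  · exact ⟨.inl ⟨0, h⟩⟩
  · exact ⟨.inr (0, ⟨0, by have := P.pos; omega⟩)⟩

/-- The image of a unit under an involution. -/
def GradedInvolution.mapUnit {𝒟 : G → Submodule 𝔽 D} (φ : GradedInvolution 𝒟) (u : Dˣ) : Dˣ where
  val := φ u
  inv := φ ((u⁻¹ : Dˣ) : D)
  val_inv := by rw [← φ.map_mul', Units.inv_mul, φ.map_one']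
  inv_val := by rw [← φ.map_mul', Units.mul_inv, φ.map_one']

theorem GradedInvolution.coe_mapUnit {𝒟 : G → Submodule 𝔽 D} (φ : GradedInvolution 𝒟) (u : Dˣ) :
    (φ.mapUnit u : D) = φ u := rfl

theorem GradedInvolution.coe_mapUnit_inv {𝒟 : G → Submodule 𝔽 D} (φ : GradedInvolution 𝒟)
    (u : Dˣ) : (((φ.mapUnit u)⁻¹ : Dˣ) : D) = φ ((u⁻¹ : Dˣ) : D) := rfl

theorem mapUnit_mem {𝒟 : G → Submodule 𝔽 D} (φ : GradedInvolution 𝒟) {u : Dˣ}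
    (hu : u ∈ homogeneousUnits 𝒟) : φ.mapUnit u ∈ homogeneousUnits 𝒟 :=
  hu.imp fun g hg => φ.map_mem' g _ hg

theorem map_mem_homogeneousUnits [Nontrivial D] {𝒟 : G → Submodule 𝔽 D} {ψ : D ≃ₐ[𝔽] D}
    (hψ : IsEquivalence 𝒟 𝒟 ψ) {u : Dˣ} (hu : u ∈ homogeneousUnits 𝒟) :
    Units.map (ψ : D →* D) u ∈ homogeneousUnits 𝒟 := by
  obtain ⟨g, hg⟩ := hu
  obtain ⟨j, hj⟩ := hψ g ((Submodule.ne_bot_iff _).2 ⟨u, hg, u.ne_zero⟩)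
  exact ⟨j, hj ▸ Submodule.mem_map_of_mem hg⟩

variable [AddGroup G] [DecidableEq G] {𝒟 : G → Submodule 𝔽 D} [GradedAlgebra 𝒟]

theorem mul_mem_homogeneousUnits {u v : Dˣ} (hu : u ∈ homogeneousUnits 𝒟)
    (hv : v ∈ homogeneousUnits 𝒟) : u * v ∈ homogeneousUnits 𝒟 := by
  obtain ⟨g, hg⟩ := hu
  obtain ⟨h, hh⟩ := hv
  exact ⟨g + h, SetLike.mul_mem_graded hg hh⟩

theorem inv_mem_homogeneousUnits {u : Dˣ} (hu : u ∈ homogeneousUnits 𝒟) :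
    u⁻¹ ∈ homogeneousUnits 𝒟 := by
  obtain ⟨g, hg⟩ := hu
  exact ⟨-g, inv_mem 𝒟 hg⟩

end Homogeneous

namespace Params

variable {𝔽 D G : Type*} [Field 𝔽] [Ring D] [Algebra 𝔽 D] [AddGroup G] [DecidableEq G]
  {𝒟 : G → Submodule 𝔽 D} [GradedAlgebra 𝒟] [IsGradedDivision 𝒟] (P : Params 𝒟)

/-! ### The components of the matrix algebra -/

theorem compD_eq {t u : P.T} {a : D} (ht : a ∈ P.compD t) (hu : a ∈ P.compD u) (ha : a ≠ 0) :
    t = u :=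
  Subtype.ext (DirectSum.degree_eq_of_mem_mem 𝒟 ht hu ha)

theorem exists_compD {g : G} {a : D} (h : a ∈ 𝒟 g) (ha : a ≠ 0) :
    ∃ t : P.T, a ∈ P.compD t :=
  ⟨(⟨g, (Submodule.ne_bot_iff _).2 ⟨a, h, ha⟩⟩ : supportSubgroup 𝒟), h⟩

theorem exists_compD_unit {u : Dˣ} (hu : u ∈ homogeneousUnits 𝒟) :
    ∃ t : P.T, (u : D) ∈ P.compD t := by
  have := IsGradedDivision.nontrivial (𝒟 := 𝒟)
  exact P.exists_compD hu.choose_spec u.ne_zero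

theorem compD_inv {u : Dˣ} {t : P.T} (hu : (u : D) ∈ P.compD t) :
    ((u⁻¹ : Dˣ) : D) ∈ P.compD (-t) :=
  inv_mem 𝒟 hu

theorem compD_isUnit {a : D} {t : P.T} (h : a ∈ P.compD t) (ha : a ≠ 0) : IsUnit a :=
  IsGradedDivision.isUnit (𝒟 := 𝒟) _ a h ha

/-- The degree `g̃ᵢ - g̃ⱼ + t` of `E_{ij} ⊗ a`, for `a` of degree `t`. -/
noncomputable def edeg (i j : Idx P.q P.s) (t : P.T) : P.Gt :=
  GTilde.gen P.s P.deg i - GTilde.gen P.s P.deg j + GTilde.ofT P.s P.deg t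

theorem edeg_injective (i j : Idx P.q P.s) : Function.Injective (P.edeg i j) := fun _ _ h =>
  GTilde.ofT_injective P.s P.deg (add_left_cancel h)

theorem edeg_self_zero (i : Idx P.q P.s) : P.edeg i i 0 = 0 := by
  simp [edeg]

theorem mem_comp_iff {g : P.Gt} {X : P.Alg} :
    X ∈ P.comp g ↔ ∀ i j, X i j ≠ 0 → ∃ t, X i j ∈ P.compD t ∧ P.edeg i j t = g := by
  constructor
  · intro h
    induction h using Submodule.span_induction with
    | mem X h =>
      obtain ⟨i, j, t, a, ha, hg, rfl⟩ := h
      intro k l hkl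
      rw [Matrix.single_apply] at hkl ⊢
      split_ifs at hkl ⊢ with h
      · obtain ⟨rfl, rfl⟩ := h
        exact ⟨t, ha, hg⟩
      · exact absurd rfl hkl
    | zero => intro i j h; exact absurd rfl h
    | add X Y _ _ hX hY =>
      intro i j h
      rw [Matrix.add_apply] at h ⊢
      by_cases hx : X i j = 0
      · rw [hx, zero_add] at h ⊢
        exact hY i j h
      by_cases hy : Y i j = 0
      · rw [hy, add_zero] at h ⊢
        exact hX i j h
      obtain ⟨t, ht, h1⟩ := hX i j hx
      obtain ⟨u, hu, h2⟩ := hY i j hy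
      obtain rfl := P.edeg_injective i j (h1.trans h2.symm)
      exact ⟨t, Submodule.add_mem _ ht hu, h1⟩
    | smul c X _ hX =>
      intro i j h
      have hx : X i j ≠ 0 := by
        rintro h0
        simp [h0] at h
      obtain ⟨t, ht, h1⟩ := hX i j hx
      exact ⟨t, Submodule.smul_mem _ c ht, h1⟩
  · intro h
    rw [Matrix.matrix_eq_sum_single X]
    refine Submodule.sum_mem _ fun i _ => Submodule.sum_mem _ fun j _ => ?_
    by_cases hx : X i j = 0
    · simp [hx]
    · obtain ⟨t, ht, h1⟩ := h i j hx
      exact Submodule.subset_span ⟨i, j, t, _, ht, h1, rfl⟩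

theorem single_mem_comp {t : P.T} {a : D} (ha : a ∈ P.compD t) (i j : Idx P.q P.s) :
    Matrix.single i j a ∈ P.comp (P.edeg i j t) :=
  Submodule.subset_span ⟨i, j, t, a, ha, rfl, rfl⟩

theorem one_mem_compD : (1 : D) ∈ P.compD 0 := SetLike.one_mem_graded 𝒟

theorem single_one_mem_comp (i : Idx P.q P.s) :
    Matrix.single i i (1 : D) ∈ P.comp 0 := by
  have h := P.single_mem_comp P.one_mem_compD i i
  rwa [edeg_self_zero] at h

theorem one_mem_comp : (1 : P.Alg) ∈ P.comp 0 := by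
  rw [← Matrix.sum_single_one]
  exact Submodule.sum_mem _ fun i _ => P.single_one_mem_comp i

/-- The component of degree zero consists of the diagonal matrices over the division algebra of
degree zero. -/
theorem mem_comp_zero {X : P.Alg} (h : X ∈ P.comp 0) :
    (∀ i j, i ≠ j → X i j = 0) ∧ ∀ i, X i i ≠ 0 → IsUnit (X i i) := by
  rw [mem_comp_iff] at h
  constructor
  · intro i j hij
    by_contra hx
    obtain ⟨t, -, ht⟩ := h i j hx
    exact hij (GTilde.gen_sub_gen_add_ofT_eq_zero _ _ ht).1
  · intro i hx
    obtain ⟨t, ht, -⟩ := h i i hx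
    exact P.compD_isUnit ht hx

theorem eq_zero_of_one_mem_comp {g : P.Gt} (h : (1 : P.Alg) ∈ P.comp g) : g = 0 := by
  have := IsGradedDivision.nontrivial (𝒟 := 𝒟)
  obtain ⟨i⟩ := P.nonempty_idx
  obtain ⟨t, ht, h1⟩ := P.mem_comp_iff.1 h i i (by simp)
  rw [Matrix.one_apply_eq] at ht
  rw [← h1, P.compD_eq ht P.one_mem_compD one_ne_zero, edeg_self_zero]

/-! ### The involution on matrix units -/

/-- The scalar `δ = ±1` as a unit of `𝒟`. -/
def δUnit : Dˣ where
  val := algebraMap 𝔽 D P.δ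
  inv := algebraMap 𝔽 D P.δ
  val_inv := by rw [← map_mul, P.δ_mul_δ, map_one]
  inv_val := by rw [← map_mul, P.δ_mul_δ, map_one]

/-- The only nonzero entry of `Φ` in row `i`; it stands in column `star i`. -/
noncomputable def entry : Idx P.q P.s → Dˣ
  | .inl i => P.dUnit i
  | .inr (a, _) => if a = 0 then 1 else P.δUnit

theorem φ₀_entry (i : Idx P.q P.s) :
    P.φ₀ (P.entry i : D) = P.δ • (P.entry (star i) : D) := by
  rcases i with i | ⟨a, i⟩
  · simp [entry, star, coe_dUnit, P.d_symm]
  · fin_cases a <;>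
      simp [entry, star, δUnit, Algebra.algebraMap_eq_smul_one, P.φ₀_one, smul_smul, P.δ_mul_δ]

theorem entry_mem (i : Idx P.q P.s) : (P.entry i : D) ∈ P.compD (GTilde.pairDeg P.s P.deg i) := by
  rcases i with i | ⟨a, i⟩
  · exact P.d_mem i
  · fin_cases a
    · exact P.one_mem_compD
    · simp only [entry, δUnit, Algebra.algebraMap_eq_smul_one]
      exact Submodule.smul_mem _ _ P.one_mem_compD

theorem Phi_apply (i j : Idx P.q P.s) :
    (P.Phi : P.Alg) i j = if j = star i then (P.entry i : D) else 0 := by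
  rcases i with i | ⟨a, i⟩ <;> rcases j with j | ⟨b, j⟩
  · simp [Phi, star, entry, Matrix.diagonal_apply, coe_dUnit, eq_comm]
  · simp [Phi, star]
  · simp [Phi, star]
  · fin_cases a <;> fin_cases b <;>
      simp [Phi, star, entry, Matrix.blockDiagonal_apply, δUnit, eq_comm]

theorem Phi_inv_apply (i j : Idx P.q P.s) : ((P.Phi⁻¹ : P.Algˣ) : P.Alg) i j =
    if i = star j then (((P.entry j)⁻¹ : Dˣ) : D) else 0 := by
  change P.Phi.inv i j = _
  have hδ : ((P.δUnit⁻¹ : Dˣ) : D) = algebraMap 𝔽 D P.δ := rfl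
  rcases i with i | ⟨a, i⟩ <;> rcases j with j | ⟨b, j⟩
  · by_cases h : i = j
    · subst h; simp [Phi, star, entry]
    · simp [Phi, star, h]
  · simp [Phi, star]
  · simp [Phi, star]
  · fin_cases a <;> fin_cases b <;>
      simp [Phi, star, entry, Matrix.blockDiagonal_apply, hδ]

theorem involution_single (i j : Idx P.q P.s) (a : D) :
    P.involution (Matrix.single i j a) = Matrix.single (star j) (star i)
      ((((P.entry j)⁻¹ : Dˣ) : D) * P.φ₀ a * (P.entry i : D)) := by
  change P.adj _ = _
  have hc : P.conjT (Matrix.single i j a) = Matrix.single j i (P.φ₀ a) := by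
    ext k l
    simp only [conjT, Matrix.map_apply, Matrix.transpose_apply, Matrix.single_apply, and_comm]
    split_ifs <;> simp
  ext l m
  have he : P.adj (Matrix.single i j a) l m =
      ((P.Phi⁻¹ : P.Algˣ) : P.Alg) l j * P.φ₀ a * (P.Phi : P.Alg) i m := by
    rw [adj, hc, Matrix.mul_apply, Finset.sum_eq_single i]
    · simp
    · intro k _ hk
      rw [Matrix.mul_single_apply_of_ne _ _ _ _ _ hk, zero_mul]
    · simp
  rw [he, Phi_apply, Phi_inv_apply, Matrix.single_apply]
  by_cases h1 : l = star j <;> by_cases h2 : m = star i <;> simp [h1, h2, eq_comm]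

end Params

/-- For `p = u_{j*}`, `r = u_{i*}`, `f = fⱼ`, `g = fᵢ`, `y = u_j`, `x = u_i` and the entries
`f' = f'_{σ j}`, `g' = f'_{σ i}`, the first equation says that `ψ` intertwines the involutions on
`E_{ij} ⊗ a`; the second one is its rearranged form. -/
theorem intertwine_iff {𝔽 D G : Type*} [Field 𝔽] [Ring D] [Algebra 𝔽 D]
    {𝒟 : G → Submodule 𝔽 D} (φ φ' : GradedInvolution 𝒟) (ψ : D ≃ₐ[𝔽] D)
    (p r f g f' g' x y : Dˣ) (a : D) :
    (p : D) * ψ (((f⁻¹ : Dˣ) : D) * φ a * (g : D)) * ((r⁻¹ : Dˣ) : D) =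
        ((f'⁻¹ : Dˣ) : D) * φ' ((x : D) * ψ a * ((y⁻¹ : Dˣ) : D)) * (g' : D) ↔
      ((φ'.mapUnit y * f' * p * (Units.map (ψ : D →* D) f)⁻¹ : Dˣ) : D) * ψ (φ a) =
        φ' (ψ a) * ((φ'.mapUnit x * g' * r * (Units.map (ψ : D →* D) g)⁻¹ : Dˣ) : D) := by
  have hf : ψ ((f⁻¹ : Dˣ) : D) = (((Units.map (ψ : D →* D) f)⁻¹ : Dˣ) : D) := rfl
  have hg : ψ (g : D) = (Units.map (ψ : D →* D) g : D) := rfl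
  have hy : φ' ((y⁻¹ : Dˣ) : D) = (((φ'.mapUnit y)⁻¹ : Dˣ) : D) := rfl
  have hx : φ' (x : D) = (φ'.mapUnit x : D) := rfl
  rw [map_mul, map_mul, φ'.map_mul', φ'.map_mul', hf, hg, hy, hx]
  generalize φ'.mapUnit y = Y
  generalize φ'.mapUnit x = X
  generalize Units.map (ψ : D →* D) f = F
  generalize Units.map (ψ : D →* D) g = H
  rw [← (f'.isUnit).mul_right_inj, ← (Y.isUnit).mul_right_inj, ← (r.isUnit).mul_left_inj,
    ← ((H⁻¹).isUnit).mul_left_inj]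
  simp [mul_assoc]

/-! ### Isomorphisms of matrix algebras that permute the diagonal matrix units -/

section MatrixUnits

variable {𝔽 D n m : Type*} [Field 𝔽] [Ring D] [Algebra 𝔽 D] [Fintype n] [DecidableEq n]
  [Fintype m] [DecidableEq m] {ψ : Matrix n n D ≃ₐ[𝔽] Matrix m m D} {σ : n ≃ m}
  (hσ : ∀ i, ψ (Matrix.single i i 1) = Matrix.single (σ i) (σ i) 1)
include hσ

theorem map_single (i j : n) (a : D) :
    ψ (Matrix.single i j a) =
      Matrix.single (σ i) (σ j) (ψ (Matrix.single i j a) (σ i) (σ j)) := by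
  have h : Matrix.single i j a = Matrix.single i i 1 * Matrix.single i j a *
      Matrix.single j j 1 := by simp
  conv_lhs => rw [h, map_mul, map_mul, hσ, hσ, Matrix.single_mul_mul_single, one_mul, mul_one]

theorem map_single_mul (i j k : n) (a b : D) :
    ψ (Matrix.single i j a) (σ i) (σ j) * ψ (Matrix.single j k b) (σ j) (σ k) =
      ψ (Matrix.single i k (a * b)) (σ i) (σ k) := by
  have h := congrArg ψ (Matrix.single_mul_single_same (c := a) i j k b)
  rw [map_mul, map_single hσ i j, map_single hσ j k, Matrix.single_mul_single_same] at h
  rw [← h, Matrix.single_apply_same]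

theorem symm_single (i : n) :
    ψ.symm (Matrix.single (σ i) (σ i) 1) = Matrix.single i i 1 := by
  rw [← hσ, AlgEquiv.symm_apply_apply]

theorem symm_map_single (i j : n) (a : D) :
    ψ.symm (Matrix.single (σ i) (σ j) a) =
      Matrix.single i j (ψ.symm (Matrix.single (σ i) (σ j) a) i j) := by
  have h := map_single (σ := σ.symm) (ψ := ψ.symm)
    (fun i => by obtain ⟨k, rfl⟩ := σ.surjective i; simpa using symm_single hσ k) (σ i) (σ j) a
  simpa using h

/-- The map induced by an equivalence on the corners `E_{oo} ⊗ 𝒟`. -/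
noncomputable def cornerEquiv (o : n) : D ≃ₐ[𝔽] D :=
  AlgEquiv.ofLinearEquiv
    { toFun := fun a => ψ (Matrix.single o o a) (σ o) (σ o)
      map_add' := fun a b => by rw [Matrix.single_add, map_add, Matrix.add_apply]
      map_smul' := fun c a => by rw [← Matrix.smul_single, map_smul]; rfl
      invFun := fun a => ψ.symm (Matrix.single (σ o) (σ o) a) o o
      left_inv := fun a => by
        simp only
        rw [← map_single hσ, AlgEquiv.symm_apply_apply, Matrix.single_apply_same]
      right_inv := fun a => by
        simp only
        rw [← symm_map_single hσ, AlgEquiv.apply_symm_apply, Matrix.single_apply_same] }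
    (by simp [hσ]) (fun a b => (map_single_mul hσ o o o a b).symm)

theorem map_single_corner (o : n) (a : D) :
    ψ (Matrix.single o o a) = Matrix.single (σ o) (σ o) (cornerEquiv hσ o a) :=
  map_single hσ o o a

theorem symm_single_corner (o : n) (a : D) :
    ψ.symm (Matrix.single (σ o) (σ o) a) = Matrix.single o o ((cornerEquiv hσ o).symm a) :=
  symm_map_single hσ o o a

/-- The unit `uᵢ` with `ψ (E_{io} ⊗ 1) = E_{σ i, σ o} ⊗ uᵢ`. -/
noncomputable def cornerUnit (o i : n) : Dˣ where
  val := ψ (Matrix.single i o 1) (σ i) (σ o)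
  inv := ψ (Matrix.single o i 1) (σ o) (σ i)
  val_inv := by rw [map_single_mul hσ, one_mul, hσ, Matrix.single_apply_same]
  inv_val := by rw [map_single_mul hσ, one_mul, hσ, Matrix.single_apply_same]

/-- Such an isomorphism is an automorphism of `𝒟` applied entrywise, followed by a monomial
transformation. -/
theorem map_single_eq (o i j : n) (a : D) :
    ψ (Matrix.single i j a) = Matrix.single (σ i) (σ j)
      ((cornerUnit hσ o i : D) * cornerEquiv hσ o a * (((cornerUnit hσ o j)⁻¹ : Dˣ) : D)) := by
  rw [map_single hσ i j a]
  congr 1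
  change _ = ψ (Matrix.single i o 1) (σ i) (σ o) * ψ (Matrix.single o o a) (σ o) (σ o) *
    ψ (Matrix.single o j 1) (σ o) (σ j)
  rw [map_single_mul hσ, map_single_mul hσ, one_mul, mul_one]

end MatrixUnits

/-! ### Equivalences of the graded-division algebra -/

/-- The inverse of an equivalence is an equivalence: since `𝒟` is the sum of its components, every
nonzero component is hit by one of the components of `𝒟`. -/
theorem isEquivalence_symm {𝔽 D G : Type*} [Field 𝔽] [Ring D] [Algebra 𝔽 D] [AddGroup G]
    [DecidableEq G] {𝒟 : G → Submodule 𝔽 D} [GradedAlgebra 𝒟] {ψ : D ≃ₐ[𝔽] D}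
    (hψ : IsEquivalence 𝒟 𝒟 ψ) : IsEquivalence 𝒟 𝒟 ψ.symm := by
  intro i hi
  obtain ⟨j, hj⟩ : ∃ j, (𝒟 j).map ψ.toLinearMap = 𝒟 i := by
    by_contra! hne
    -- If no component is mapped onto `𝒟 i`, then the image of `ψ` has zero projection to `𝒟 i`.
    have key : ∀ y, (DirectSum.decompose 𝒟 (ψ y) i : D) = 0 := by
      intro y
      induction y using DirectSum.Decomposition.inductionOn 𝒟 with
      | zero => simp
      | @homogeneous j y =>
        by_cases hy : (y : D) = 0
        · simp [hy]
        obtain ⟨k, hk⟩ := hψ j ((Submodule.ne_bot_iff _).2 ⟨y, y.2, hy⟩)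
        have h1 : ψ (y : D) ∈ 𝒟 k := hk ▸ Submodule.mem_map_of_mem y.2
        exact DirectSum.decompose_of_mem_ne 𝒟 h1 fun h => hne j (h ▸ hk)
      | add y z hy hz => simp [hy, hz]
    obtain ⟨x, hx, hx0⟩ := (Submodule.ne_bot_iff _).1 hi
    have h1 := key (ψ.symm x)
    rw [AlgEquiv.apply_symm_apply, DirectSum.decompose_of_mem_same 𝒟 hx] at h1
    exact hx0 h1
  refine ⟨j, ?_⟩
  rw [← hj]
  ext x
  constructor
  · rintro ⟨_, ⟨y, hy, rfl⟩, rfl⟩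
    change ψ.symm (ψ y) ∈ 𝒟 j
    rwa [AlgEquiv.symm_apply_apply]
  · intro hx
    exact ⟨ψ x, ⟨x, hx, rfl⟩, ψ.symm_apply_apply x⟩

namespace Params

variable {𝔽 D G : Type*} [Field 𝔽] [Ring D] [Algebra 𝔽 D] [AddGroup G] [DecidableEq G]
  {𝒟 : G → Submodule 𝔽 D} [GradedAlgebra 𝒟] [IsGradedDivision 𝒟] {P P' : Params 𝒟}
  {ψ : P.Alg ≃ₐ[𝔽] P'.Alg}

/-! ### Diagonal idempotents under an equivalence -/

theorem map_comp_zero (hψ : IsEquivalence P.comp P'.comp ψ) :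
    (P.comp 0).map ψ.toLinearMap = P'.comp 0 := by
  have := IsGradedDivision.nontrivial (𝒟 := 𝒟)
  have : Nontrivial P.Alg := by
    have := P.nonempty_idx
    infer_instance
  obtain ⟨h, hh⟩ := hψ 0 ((Submodule.ne_bot_iff _).2 ⟨1, P.one_mem_comp, one_ne_zero⟩)
  have h1 : (1 : P'.Alg) ∈ P'.comp h := by
    rw [← hh]
    exact ⟨1, P.one_mem_comp, map_one ψ⟩
  rw [hh, P'.eq_zero_of_one_mem_comp h1]

/-- An idempotent of degree zero is diagonal with entries `0` and `1`. -/
theorem idempotent_apply {X : P.Alg} (h : X ∈ P.comp 0) (hX : X * X = X) (i : Idx P.q P.s) :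
    X i i = 0 ∨ X i i = 1 := by
  obtain ⟨h1, h2⟩ := P.mem_comp_zero h
  by_cases h0 : X i i = 0
  · exact .inl h0
  · right
    have h3 : (X * X) i i = X i i * X i i := by
      rw [Matrix.mul_apply, Finset.sum_eq_single i]
      · intro j _ hj
        rw [h1 _ _ hj, mul_zero]
      · simp
    rw [hX] at h3
    exact (h2 i h0).mul_left_cancel (by rw [mul_one]; exact h3.symm)

theorem single_mul_of_mem_comp_zero {X : P.Alg} (h : X ∈ P.comp 0) (i : Idx P.q P.s) :
    Matrix.single i i 1 * X = Matrix.single i i (X i i) := by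
  ext k l
  by_cases hk : k = i
  · subst hk
    rw [Matrix.single_mul_apply_same, one_mul, Matrix.single_apply]
    by_cases hl : k = l
    · subst hl; simp
    · simp [hl, (P.mem_comp_zero h).1 k l hl]
  · simp [Ne.symm hk, hk]

/-- An equivalence permutes the diagonal matrix units, which are the minimal idempotents of the
component of degree zero. -/
theorem exists_perm (hψ : IsEquivalence P.comp P'.comp ψ) :
    ∃ σ : Idx P.q P.s ≃ Idx P'.q P'.s, ∀ i,
      ψ (Matrix.single i i 1) = Matrix.single (σ i) (σ i) 1 := by
  have := IsGradedDivision.nontrivial (𝒟 := 𝒟)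
  have h0 := map_comp_zero hψ
  have hmem : ∀ X ∈ P.comp 0, ψ X ∈ P'.comp 0 := fun X hX => h0 ▸ ⟨X, hX, rfl⟩
  have hne : ∀ {i : Idx P.q P.s}, Matrix.single i i (1 : D) ≠ 0 := fun {i} h => by
    simpa using congrFun (congrFun h i) i
  have hne' : ∀ {i : Idx P'.q P'.s}, Matrix.single i i (1 : D) ≠ 0 := fun {i} h => by
    simpa using congrFun (congrFun h i) i
  have key : ∀ i', ∃ i, ψ (Matrix.single i i 1) = Matrix.single i' i' 1 := by
    intro i'
    obtain ⟨X, hX, hXi⟩ : Matrix.single i' i' (1 : D) ∈ (P.comp 0).map ψ.toLinearMap :=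
      h0 ▸ P'.single_one_mem_comp i'
    replace hXi : ψ X = Matrix.single i' i' 1 := hXi
    have hXX : X * X = X := ψ.injective (by rw [map_mul, hXi]; simp)
    have hX0 : X ≠ 0 := by
      rintro rfl
      exact hne' (i := i') (by rw [← hXi, map_zero])
    obtain ⟨i, hi⟩ : ∃ i, X i i ≠ 0 := by
      by_contra! hall
      refine hX0 (Matrix.ext fun i j => ?_)
      by_cases hij : i = j
      · subst hij; exact hall i
      · exact (P.mem_comp_zero hX).1 i j hij
    have h1 : X i i = 1 := (idempotent_apply hX hXX i).resolve_left hi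
    refine ⟨i, ?_⟩
    -- The product of `E_{ii}` and `X` is `E_{ii}`, while `ψ X` is a minimal idempotent.
    have h2 := single_mul_of_mem_comp_zero hX i
    rw [h1] at h2
    have hY := hmem _ (P.single_one_mem_comp i)
    have hYY : ψ (Matrix.single i i 1) * ψ (Matrix.single i i 1) = ψ (Matrix.single i i 1) := by
      rw [← map_mul]; simp
    have h3 : ψ (Matrix.single i i 1) * Matrix.single i' i' 1 = ψ (Matrix.single i i 1) := by
      rw [← hXi, ← map_mul, h2]
    have h4 : Matrix.single i' i' 1 * ψ (Matrix.single i i 1) = ψ (Matrix.single i i 1) := by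
      have h5 : X * Matrix.single i i 1 = Matrix.single i i 1 := by
        ext k l
        by_cases hl : l = i
        · subst hl
          rw [Matrix.mul_single_apply_same, mul_one]
          by_cases hk : k = l
          · subst hk; simp [h1]
          · rw [(P.mem_comp_zero hX).1 k l hk, Matrix.single_apply_of_row_ne (Ne.symm hk)]
        · rw [Matrix.mul_single_apply_of_ne _ _ _ _ _ hl,
            Matrix.single_apply_of_col_ne _ _ (Ne.symm hl)]
      rw [← hXi, ← map_mul, h5]
    rw [single_mul_of_mem_comp_zero hY] at h4
    rcases idempotent_apply hY hYY i' with h | h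
    · rw [h, Matrix.single_zero] at h4
      exact absurd (ψ.injective (h4.symm.trans (map_zero ψ).symm)) hne
    · rw [← h4, h]
  choose ρ hρ using key
  have hinj : Function.Injective ρ := by
    intro a b hab
    have h := (hρ a).symm.trans ((congrArg (fun i => ψ (Matrix.single i i 1)) hab).trans (hρ b))
    by_contra hne
    have := congrFun (congrFun h a) a
    rw [Matrix.single_apply_same, Matrix.single_apply_of_row_ne (Ne.symm hne)] at this
    exact one_ne_zero this
  have hsurj : Function.Surjective ρ := by
    intro i
    by_contra! hall
    -- Otherwise `ψ E_{ii}` is orthogonal to every `E'_{i'i'}`, hence to their sum `1`.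
    refine hne (i := i) ?_
    apply ψ.injective
    rw [map_zero, ← mul_one (ψ (Matrix.single i i 1)), ← Matrix.sum_single_one, Finset.mul_sum]
    refine Finset.sum_eq_zero fun i' _ => ?_
    rw [← hρ i', ← map_mul, Matrix.single_mul_single_of_ne _ _ _ _ (hall i').symm, map_zero]
  refine ⟨(Equiv.ofBijective ρ ⟨hinj, hsurj⟩).symm, fun i => ?_⟩
  have h := hρ ((Equiv.ofBijective ρ ⟨hinj, hsurj⟩).symm i)
  rwa [Equiv.ofBijective_apply_symm_apply ρ ⟨hinj, hsurj⟩] at h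

theorem perm_star (hφ : ∀ a, ψ (P.involution a) = P'.involution (ψ a))
    {σ : Idx P.q P.s ≃ Idx P'.q P'.s}
    (hσ : ∀ i, ψ (Matrix.single i i 1) = Matrix.single (σ i) (σ i) 1) (i : Idx P.q P.s) :
    σ (star i) = star (σ i) := by
  have := IsGradedDivision.nontrivial (𝒟 := 𝒟)
  have h := hφ (Matrix.single i i 1)
  rw [hσ, involution_single, involution_single, P.φ₀_one, P'.φ₀_one] at h
  simp only [mul_one, Units.inv_mul, hσ] at h
  by_contra hne
  have h1 := congrFun (congrFun h (σ (star i))) (σ (star i))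
  rw [Matrix.single_apply_same, Matrix.single_apply_of_row_ne (Ne.symm hne)] at h1
  exact one_ne_zero h1

/-- The fixed points of `star` are the first `q` indices, so a bijection that commutes with `star`
restricts to them. -/
theorem exists_perm_inl {q s q' s' : ℕ} {σ : Idx q s ≃ Idx q' s'}
    (h : ∀ i, σ (star i) = star (σ i)) :
    ∃ π : Fin q' ≃ Fin q, ∀ i, σ (.inl (π i)) = .inl i := by
  have h1 : ∀ i, ∃ k, σ (.inl i) = .inl k := fun i =>
    (star_eq_self_iff _).1 (by rw [← h]; rfl)
  have h2 : ∀ i, ∃ k, σ.symm (.inl i) = .inl k := fun i =>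
    (star_eq_self_iff _).1 (σ.injective (by rw [h, Equiv.apply_symm_apply]; rfl))
  choose f hf using h1
  choose g hg using h2
  refine ⟨⟨g, f, fun i => ?_, fun i => ?_⟩, fun i => ?_⟩
  · apply Sum.inl_injective (β := Fin 2 × Fin s')
    rw [← hf, ← hg, Equiv.apply_symm_apply]
  · apply Sum.inl_injective (β := Fin 2 × Fin s)
    rw [← hg, ← hf, Equiv.symm_apply_apply]
  · change σ (.inl (g i)) = _
    rw [← hg, Equiv.apply_symm_apply]

/-! ### Homogeneity of the parts of an equivalence -/

section Shape

variable {σ : Idx P.q P.s ≃ Idx P'.q P'.s}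
  (hσ : ∀ i, ψ (Matrix.single i i 1) = Matrix.single (σ i) (σ i) 1)
include hσ

theorem cornerUnit_mem (hψ : IsEquivalence P.comp P'.comp ψ) (o i : Idx P.q P.s) :
    cornerUnit hσ o i ∈ homogeneousUnits 𝒟 := by
  have := IsGradedDivision.nontrivial (𝒟 := 𝒟)
  have h1 := P.single_mem_comp P.one_mem_compD i o
  obtain ⟨h, hh⟩ := hψ _ ((Submodule.ne_bot_iff _).2 ⟨_, h1, fun h0 => by
    simpa using congrFun (congrFun h0 i) o⟩)
  have h2 : ψ (Matrix.single i o 1) ∈ P'.comp h := hh ▸ ⟨_, h1, rfl⟩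
  obtain ⟨t, ht, -⟩ := P'.mem_comp_iff.1 h2 (σ i) (σ o) (cornerUnit hσ o i).ne_zero
  exact ⟨_, ht⟩

theorem cornerEquiv_isEquivalence (hψ : IsEquivalence P.comp P'.comp ψ) (o : Idx P.q P.s) :
    IsEquivalence 𝒟 𝒟 (cornerEquiv hσ o) := by
  intro g hg
  obtain ⟨x, hx, hx0⟩ := (Submodule.ne_bot_iff _).1 hg
  let t : P.T := (⟨g, hg⟩ : supportSubgroup 𝒟)
  have hxt : x ∈ P.compD t := hx
  have h1 := P.single_mem_comp hxt o o
  obtain ⟨h, hh⟩ := hψ _ ((Submodule.ne_bot_iff _).2 ⟨_, h1, fun h0 => hx0 (by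
    simpa using congrFun (congrFun h0 o) o)⟩)
  -- All nonzero images of homogeneous elements of degree `t` have the degree of the image of `x`.
  have himg : ∀ y ∈ P.compD t, cornerEquiv hσ o y ≠ 0 →
      ∃ t', cornerEquiv hσ o y ∈ P'.compD t' ∧ P'.edeg (σ o) (σ o) t' = h := by
    intro y hy hy0
    have h2 : ψ (Matrix.single o o y) ∈ P'.comp h := hh ▸ ⟨_, P.single_mem_comp hy o o, rfl⟩
    rw [map_single_corner hσ] at h2
    have h3 := P'.mem_comp_iff.1 h2 (σ o) (σ o)
    rw [Matrix.single_apply_same] at h3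
    exact h3 hy0
  have hcx : cornerEquiv hσ o x ≠ 0 := by simpa using hx0
  obtain ⟨t', -, ht'⟩ := himg x hxt hcx
  refine ⟨(show supportSubgroup 𝒟 from t').1, le_antisymm ?_ ?_⟩
  · rintro _ ⟨y, hy, rfl⟩
    change cornerEquiv hσ o y ∈ P'.compD t'
    by_cases hy0 : cornerEquiv hσ o y = 0
    · rw [hy0]; exact Submodule.zero_mem _
    obtain ⟨t2, h2, h3⟩ := himg y hy hy0
    rwa [P'.edeg_injective _ _ (ht'.trans h3.symm)]
  · intro z hz
    have h2 : Matrix.single (σ o) (σ o) z ∈ P'.comp h := by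
      rw [← ht']
      exact P'.single_mem_comp hz _ _
    rw [← hh] at h2
    obtain ⟨X, hX, hXz⟩ := h2
    replace hXz : X = Matrix.single o o ((cornerEquiv hσ o).symm z) := by
      rw [← symm_single_corner hσ, ← hXz]
      exact (ψ.symm_apply_apply X).symm
    refine ⟨(cornerEquiv hσ o).symm z, ?_, (cornerEquiv hσ o).apply_symm_apply z⟩
    by_cases hz0 : (cornerEquiv hσ o).symm z = 0
    · rw [hz0]; exact Submodule.zero_mem _
    have h3 := P.mem_comp_iff.1 (hXz ▸ hX) o o
    rw [Matrix.single_apply_same] at h3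
    obtain ⟨t2, h4, h5⟩ := h3 hz0
    rw [P.edeg_injective _ _ h5] at h4
    exact h4

end Shape

/-! ### Invariants of an equivalence of graded algebras with involution -/

theorem exists_data_of_equivalent
    (h : EquivalentWithInvolution P.involution P'.involution) :
    P'.q = P.q ∧ P'.s = P.s ∧
      ∃ ψ₀ : D ≃ₐ[𝔽] D, IsEquivalence 𝒟 𝒟 ψ₀ ∧
        ∃ c₀ ∈ homogeneousUnits 𝒟,
          (∀ x : D, P'.φ₀ x = (c₀ : D) * ψ₀ (P.φ₀ (ψ₀.symm x)) * ((c₀⁻¹ : Dˣ) : D)) ∧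
          P'.φ₀ (c₀ : D) = (P.δ * P'.δ) • (c₀ : D) ∧
          ∃ c : Fin P.q → Dˣ, (∀ i, c i ∈ homogeneousUnits 𝒟) ∧
            ∃ π : Fin P'.q ≃ Fin P.q, ∀ i,
              P'.d i =
                (c₀ : D) * ψ₀ ((c (π i) : D) * P.d (π i) * P.φ₀ (c (π i) : D)) := by
  have hnt := IsGradedDivision.nontrivial (𝒟 := 𝒟)
  obtain ⟨ψ, hψ, hφ⟩ := h
  obtain ⟨σ, hσ⟩ := exists_perm hψ
  have hstar := perm_star hφ hσ
  obtain ⟨π, hπ⟩ := exists_perm_inl hstar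
  obtain ⟨o⟩ := P.nonempty_idx
  have hq : P'.q = P.q := by simpa using Fintype.card_congr π
  have hs : P'.s = P.s := by
    have := Fintype.card_congr σ
    simp only [Fintype.card_sum, Fintype.card_prod, Fintype.card_fin] at this
    omega
  obtain ⟨ψ₀, hψ₀⟩ : ∃ ψ₀, cornerEquiv hσ o = ψ₀ := ⟨_, rfl⟩
  have heq : IsEquivalence 𝒟 𝒟 ψ₀ := hψ₀ ▸ cornerEquiv_isEquivalence hσ hψ o
  obtain ⟨u, hu⟩ : ∃ u, cornerUnit hσ o = u := ⟨_, rfl⟩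
  have hum : ∀ i, u i ∈ homogeneousUnits 𝒟 := hu ▸ cornerUnit_mem hσ hψ o
  have hentry : ∀ i, P.entry i ∈ homogeneousUnits 𝒟 := fun i => ⟨_, P.entry_mem i⟩
  have hentry' : ∀ i, P'.entry i ∈ homogeneousUnits 𝒟 := fun i => ⟨_, P'.entry_mem i⟩
  obtain ⟨c, hc⟩ : ∃ c : Idx P.q P.s → Dˣ, ∀ i, c i = P'.φ₀.mapUnit (u i) * P'.entry (σ i) *
    u (star i) * (Units.map (ψ₀ : D →* D) (P.entry i))⁻¹ := ⟨_, fun _ => rfl⟩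
  have hcomm : ∀ i j a, (c j : D) * ψ₀ (P.φ₀ a) = P'.φ₀ (ψ₀ a) * (c i : D) := by
    intro i j a
    have h1 := hφ (Matrix.single i j a)
    rw [map_single_eq hσ o i j, involution_single, involution_single,
      map_single_eq hσ o, hψ₀, hu, hstar, hstar] at h1
    have h2 := congrFun (congrFun h1 (star (σ j))) (star (σ i))
    rw [Matrix.single_apply_same, Matrix.single_apply_same, intertwine_iff, ← hc, ← hc] at h2
    exact h2
  have hconst : ∀ i, c i = c o := by
    intro i
    have h1 := hcomm o i 1
    rw [P.φ₀_one, map_one, P'.φ₀_one, one_mul, mul_one] at h1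
    exact Units.ext h1
  have hrel : ∀ i, c o * Units.map (ψ₀ : D →* D) (P.entry i) =
      P'.φ₀.mapUnit (u i) * P'.entry (σ i) * u (star i) := by
    intro i
    rw [← hconst i, hc, inv_mul_cancel_right]
  have hinv : ∀ x : D, P'.φ₀ x =
      (c o : D) * ψ₀ (P.φ₀ (ψ₀.symm x)) * (((c o)⁻¹ : Dˣ) : D) := by
    intro x
    rw [hcomm o o, AlgEquiv.apply_symm_apply, mul_assoc, Units.mul_inv, mul_one]
  -- The units that multiply the `dᵢ` are `φ₀(ψ₀⁻¹(uᵢ⁻¹))`: solve `hrel` for `d'`, and move `c₀` to the left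
  -- of `φ₀'(uᵢ)⁻¹` by means of `hinv`.
  refine ⟨hq, hs, ψ₀, heq, c o, ?_, hinv, ?_, fun i => P.φ₀.mapUnit
    (Units.map (ψ₀.symm : D →* D) (u (.inl i))⁻¹), ?_, π, ?_⟩
  · rw [hc]
    exact mul_mem_homogeneousUnits (mul_mem_homogeneousUnits (mul_mem_homogeneousUnits
      (mapUnit_mem _ (hum _)) (hentry' _)) (hum _))
      (inv_mem_homogeneousUnits (map_mem_homogeneousUnits heq (hentry _)))
  · -- Apply `φ₀'` to the relation between `c₀`, the `uᵢ` and the entries of the two matrices `Φ`.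
    have h1 := congrArg (fun x : Dˣ => P'.φ₀ (x : D)) (hrel o)
    simp only [Units.val_mul, P'.φ₀.map_mul', GradedInvolution.coe_mapUnit,
      P'.φ₀.involutive', P'.φ₀_entry] at h1
    have h2 : (c o : D) * ψ₀ (P.entry (star o) : D) =
        P'.φ₀ (u (star o) : D) * (P'.entry (star (σ o)) : D) * (u o : D) := by
      have h := congrArg Units.val (hrel (star o))
      rw [star_star, hstar] at h
      exact h
    have h3 : P'.φ₀ ((Units.map (ψ₀ : D →* D) (P.entry o) : Dˣ) : D) =
        P.δ • ((c o : D) * ψ₀ (P.entry (star o) : D) * (((c o)⁻¹ : Dˣ) : D)) := by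
      rw [hinv]
      have : ψ₀.symm ((Units.map (ψ₀ : D →* D) (P.entry o) : Dˣ) : D) = P.entry o :=
        ψ₀.symm_apply_apply _
      rw [this, P.φ₀_entry, map_smul, mul_smul_comm, smul_mul_assoc]
    rw [h3, smul_mul_assoc, smul_mul_assoc, mul_smul_comm, ← mul_assoc (P'.φ₀ _)] at h1
    rw [← h2, mul_assoc] at h1
    have h4 : (((c o)⁻¹ : Dˣ) : D) * P'.φ₀ (c o : D) = (P.δ * P'.δ) • 1 := by
      have h5 := congrArg (P.δ • ·) h1
      simp only [smul_smul, P.δ_mul_δ, one_smul] at h5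
      have h6 : IsUnit ((c o : D) * ψ₀ (P.entry (star o) : D)) :=
        (c o * Units.map (ψ₀ : D →* D) (P.entry (star o))).isUnit
      refine h6.mul_left_cancel ?_
      rw [h5, mul_smul_comm, mul_one]
    calc P'.φ₀ (c o : D) = (c o : D) * ((((c o)⁻¹ : Dˣ) : D) * P'.φ₀ (c o : D)) := by
          rw [Units.mul_inv_cancel_left]
      _ = _ := by rw [h4, mul_smul_comm, mul_one]
  · intro i
    exact mapUnit_mem _ (map_mem_homogeneousUnits (isEquivalence_symm heq)
      (inv_mem_homogeneousUnits (hum _)))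
  · intro i
    have h1 := hrel (.inl (π i))
    have h2 : P'.φ₀ (((u (.inl (π i)))⁻¹ : Dˣ) : D) * (c o : D) = (c o : D) *
        ψ₀ (P.φ₀ (ψ₀.symm (((u (.inl (π i)))⁻¹ : Dˣ) : D))) := by
      rw [hinv, mul_assoc, Units.inv_mul, mul_one]
    have h3 : P'.dUnit i = (P'.φ₀.mapUnit (u (.inl (π i))))⁻¹ *
        (c o * Units.map (ψ₀ : D →* D) (P.dUnit (π i))) * (u (.inl (π i)))⁻¹ := by
      change c o * Units.map (ψ₀ : D →* D) (P.dUnit (π i)) =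
        P'.φ₀.mapUnit (u (.inl (π i))) * P'.entry (σ (.inl (π i))) * u (.inl (π i)) at h1
      rw [h1, hπ]
      simp only [entry]
      group
    have h4 := congrArg (fun x : Dˣ => (x : D)) h3
    simp only [Units.val_mul, GradedInvolution.coe_mapUnit_inv, coe_dUnit] at h4
    rw [h4, ← mul_assoc, h2, GradedInvolution.coe_mapUnit, P.φ₀.involutive', map_mul, map_mul]
    have h5 : ((Units.map (ψ₀ : D →* D) (P.dUnit (π i)) : Dˣ) : D) = ψ₀ (P.d (π i)) := rfl
    have h6 : ((Units.map (ψ₀.symm : D →* D) (u (.inl (π i)))⁻¹ : Dˣ) : D) =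
      ψ₀.symm (((u (.inl (π i)))⁻¹ : Dˣ) : D) := rfl
    rw [h5, h6, AlgEquiv.apply_symm_apply]
    simp only [mul_assoc]

end Params

/-! ### Monomial isomorphisms -/

/-- The isomorphism `E_{ij} ⊗ a ↦ E_{σ i, σ j} ⊗ uᵢ ψ₀(a) uⱼ⁻¹` of matrix algebras. -/
def monomialEquiv {𝔽 D n m : Type*} [Field 𝔽] [Ring D] [Algebra 𝔽 D] [Fintype n] [DecidableEq n]
    [Fintype m] [DecidableEq m] (σ : n ≃ m) (u : n → Dˣ) (ψ₀ : D ≃ₐ[𝔽] D) :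
    Matrix n n D ≃ₐ[𝔽] Matrix m m D :=
  AlgEquiv.ofLinearEquiv
    { toFun := fun X => Matrix.of fun i j =>
        (u (σ.symm i) : D) * ψ₀ (X (σ.symm i) (σ.symm j)) * (((u (σ.symm j))⁻¹ : Dˣ) : D)
      map_add' := fun X Y => by ext i j; simp [mul_add, add_mul]
      map_smul' := fun c X => by ext i j; simp
      invFun := fun Y => Matrix.of fun i j =>
        ψ₀.symm ((((u i)⁻¹ : Dˣ) : D) * Y (σ i) (σ j) * (u j : D))
      left_inv := fun X => by ext i j; simp [mul_assoc]
      right_inv := fun Y => by ext i j; simp [mul_assoc] }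
    (by
      ext i j
      by_cases h : i = j
      · subst h; simp
      · simp [h])
    (fun X Y => by
      ext i j
      simp only [LinearEquiv.coe_mk, LinearMap.coe_mk, AddHom.coe_mk, Matrix.of_apply,
        Matrix.mul_apply, map_sum, map_mul, Finset.mul_sum, Finset.sum_mul]
      rw [← σ.symm.sum_comp]
      refine Finset.sum_congr rfl fun k _ => ?_
      simp [mul_assoc])

section MonomialEquiv

variable {𝔽 D n m : Type*} [Field 𝔽] [Ring D] [Algebra 𝔽 D] [Fintype n] [DecidableEq n]
  [Fintype m] [DecidableEq m] (σ : n ≃ m) (u : n → Dˣ) (ψ₀ : D ≃ₐ[𝔽] D)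

theorem monomialEquiv_apply (X : Matrix n n D) (i j : n) :
    monomialEquiv σ u ψ₀ X (σ i) (σ j) =
      (u i : D) * ψ₀ (X i j) * (((u j)⁻¹ : Dˣ) : D) := by
  change (u (σ.symm (σ i)) : D) * ψ₀ (X (σ.symm (σ i)) (σ.symm (σ j))) *
    (((u (σ.symm (σ j)))⁻¹ : Dˣ) : D) = _
  simp only [Equiv.symm_apply_apply]

theorem monomialEquiv_symm_apply (Y : Matrix m m D) (i j : n) :
    (monomialEquiv σ u ψ₀).symm Y i j =
      ψ₀.symm ((((u i)⁻¹ : Dˣ) : D) * Y (σ i) (σ j) * (u j : D)) := rfl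

theorem monomialEquiv_single (i j : n) (a : D) :
    monomialEquiv σ u ψ₀ (Matrix.single i j a) =
      Matrix.single (σ i) (σ j) ((u i : D) * ψ₀ a * (((u j)⁻¹ : Dˣ) : D)) := by
  ext k l
  obtain ⟨k, rfl⟩ := σ.surjective k
  obtain ⟨l, rfl⟩ := σ.surjective l
  rw [monomialEquiv_apply, Matrix.single_apply, Matrix.single_apply]
  simp only [σ.injective.eq_iff]
  split_ifs with h
  · rw [h.1, h.2]
  · simp

end MonomialEquiv

namespace Params

variable {𝔽 D G : Type*} [Field 𝔽] [Ring D] [Algebra 𝔽 D] [AddGroup G] [DecidableEq G]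
  {𝒟 : G → Submodule 𝔽 D} [GradedAlgebra 𝒟] [IsGradedDivision 𝒟] {P P' : Params 𝒟}

theorem exists_degreeHom (P P' : Params 𝒟) {ψ₀ : D ≃ₐ[𝔽] D} (hψ : IsEquivalence 𝒟 𝒟 ψ₀) :
    ∃ τ : P.T →+ P'.T, ∀ t, ∀ a ∈ P.compD t, ψ₀ a ∈ P'.compD (τ t) := by
  have hne : ∀ t : P.T, ∃ a ∈ P.compD t, a ≠ 0 := fun t =>
    (Submodule.ne_bot_iff _).1 (show supportSubgroup 𝒟 from t).2
  have hex : ∀ t : P.T, ∃ t' : P'.T, ∀ a ∈ P.compD t, ψ₀ a ∈ P'.compD t' := by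
    intro t
    obtain ⟨a, ha, ha0⟩ := hne t
    obtain ⟨j, hj⟩ := hψ _ (show supportSubgroup 𝒟 from t).2
    have h : ∀ a ∈ P.compD t, ψ₀ a ∈ 𝒟 j := fun a ha => hj ▸ Submodule.mem_map_of_mem ha
    exact ⟨(⟨j, (Submodule.ne_bot_iff _).2 ⟨ψ₀ a, h a ha, by simpa using ha0⟩⟩ :
      supportSubgroup 𝒟), h⟩
  choose τ hτ using hex
  refine ⟨AddMonoidHom.mk' τ fun t u => ?_, hτ⟩
  obtain ⟨a, ha, ha0⟩ := hne t
  obtain ⟨b, hb, hb0⟩ := hne u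
  have hab : a * b ≠ 0 := by rwa [Ne, (P.compD_isUnit ha ha0).mul_right_eq_zero]
  refine P'.compD_eq (hτ _ _ (P.mul_mem_compD ha hb)) ?_
    ((map_ne_zero_iff ψ₀ ψ₀.injective).2 hab)
  rw [map_mul]
  exact P'.mul_mem_compD (hτ _ _ ha) (hτ _ _ hb)

/-- An equivalence of the graded-division algebra `𝒟` with itself induces an automorphism of the
support. -/
theorem exists_degreeEquiv (P P' : Params 𝒟) {ψ₀ : D ≃ₐ[𝔽] D} (hψ : IsEquivalence 𝒟 𝒟 ψ₀) :
    ∃ τ : P.T ≃+ P'.T, (∀ t, ∀ a ∈ P.compD t, ψ₀ a ∈ P'.compD (τ t)) ∧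
      ∀ t, ∀ a ∈ P'.compD t, ψ₀.symm a ∈ P.compD (τ.symm t) := by
  obtain ⟨τ, hτ⟩ := P.exists_degreeHom P' hψ
  obtain ⟨ρ, hρ⟩ := P'.exists_degreeHom P (isEquivalence_symm hψ)
  refine ⟨τ.toAddEquiv ρ ?_ ?_, hτ, hρ⟩
  · ext t
    obtain ⟨a, ha, ha0⟩ := (Submodule.ne_bot_iff _).1 (show supportSubgroup 𝒟 from t).2
    have h := hρ _ _ (hτ t a ha)
    rw [AlgEquiv.symm_apply_apply] at h
    exact P.compD_eq h ha ha0
  · ext t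
    obtain ⟨a, ha, ha0⟩ := (Submodule.ne_bot_iff _).1 (show supportSubgroup 𝒟 from t).2
    have h := hτ _ _ (hρ t a ha)
    rw [AlgEquiv.apply_symm_apply] at h
    exact P'.compD_eq h ha ha0

/-- The homomorphism of grading groups given by `g̃ᵢ ↦ g̃_{σ i} + eᵢ` and by `τ` on the support,
described by its values on the degrees of homogeneous elements. -/
theorem exists_gradingHom {σ : Idx P.q P.s ≃ Idx P'.q P'.s}
    (hstar : ∀ i, σ (star i) = star (σ i)) (τ : P.T →+ P'.T) (e : Idx P.q P.s → P'.T) (κ : P'.T)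
    (h : ∀ i, κ + τ (GTilde.pairDeg P.s P.deg i) =
      e i + GTilde.pairDeg P'.s P'.deg (σ i) + e (star i)) :
    ∃ α : P.Gt →+ P'.Gt, ∀ i j t,
      α (P.edeg i j t) = P'.edeg (σ i) (σ j) (e i + τ t - e j) := by
  obtain ⟨α, h1, h2⟩ := GTilde.exists_hom P.s P.deg (A := P'.Gt)
    (fun i => GTilde.gen P'.s P'.deg (σ i) + GTilde.ofT P'.s P'.deg (e i))
    ((GTilde.ofT P'.s P'.deg).comp τ) (by
      have key : ∀ i, GTilde.gen P'.s P'.deg (σ i) + GTilde.ofT P'.s P'.deg (e i) +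
          (GTilde.gen P'.s P'.deg (σ (star i)) + GTilde.ofT P'.s P'.deg (e (star i))) -
          (GTilde.ofT P'.s P'.deg).comp τ (GTilde.pairDeg P.s P.deg i) =
          (GTilde.gen P'.s P'.deg (σ i) + GTilde.gen P'.s P'.deg (star (σ i)) -
            GTilde.ofT P'.s P'.deg (GTilde.pairDeg P'.s P'.deg (σ i))) +
          GTilde.ofT P'.s P'.deg κ := by
        intro i
        have h3 := congrArg (GTilde.ofT P'.s P'.deg) (h i)
        simp only [map_add] at h3
        rw [hstar, AddMonoidHom.comp_apply, ← sub_eq_zero]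
        rw [← sub_eq_zero] at h3
        rw [← neg_eq_zero, ← h3]
        abel
      intro i j
      rw [key, key, GTilde.gen_add_gen_star_eq P'.s P'.deg (σ i) (σ j)])
  refine ⟨α, fun i j t => ?_⟩
  simp only [edeg, map_add, map_sub, h1, h2, AddMonoidHom.comp_apply]
  abel

/-- A monomial isomorphism is an equivalence of graded algebras if the degrees of its parts are
compatible with the relations that define the grading groups. -/
theorem monomialEquiv_isEquivalence {σ : Idx P.q P.s ≃ Idx P'.q P'.s}
    (hstar : ∀ i, σ (star i) = star (σ i)) {u : Idx P.q P.s → Dˣ}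
    (hu : ∀ i, u i ∈ homogeneousUnits 𝒟) {ψ₀ : D ≃ₐ[𝔽] D} (hψ : IsEquivalence 𝒟 𝒟 ψ₀)
    {c₀ : Dˣ} (hc₀ : c₀ ∈ homogeneousUnits 𝒟)
    (hrel : ∀ i, c₀ * Units.map (ψ₀ : D →* D) (P.entry i) =
      P'.φ₀.mapUnit (u i) * P'.entry (σ i) * u (star i)) :
    IsEquivalence P.comp P'.comp (monomialEquiv σ u ψ₀) := by
  have := IsGradedDivision.nontrivial (𝒟 := 𝒟)
  obtain ⟨τ, hτ, hτ'⟩ := P.exists_degreeEquiv P' hψ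
  choose e he using fun i => P'.exists_compD_unit (hu i)
  obtain ⟨κ, hκ⟩ := P'.exists_compD_unit hc₀
  have hdeg : ∀ i, κ + τ (GTilde.pairDeg P.s P.deg i) =
      e i + GTilde.pairDeg P'.s P'.deg (σ i) + e (star i) := by
    intro i
    refine P'.compD_eq (P'.mul_mem_compD hκ (hτ _ _ (P.entry_mem i))) ?_
      (c₀ * Units.map (ψ₀ : D →* D) (P.entry i)).ne_zero
    have h := congrArg Units.val (hrel i)
    change (c₀ : D) * ψ₀ (P.entry i) = _ at h
    rw [h]
    exact P'.mul_mem_compD (P'.mul_mem_compD (P'.φ₀.map_mem' _ _ (he i)) (P'.entry_mem (σ i)))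
      (he (star i))
  obtain ⟨α, hα⟩ := exists_gradingHom hstar (τ : P.T →+ P'.T) e κ hdeg
  -- The inverse of `α` on degrees comes from the inverse monomial isomorphism.
  obtain ⟨β, hβ⟩ := exists_gradingHom (P := P') (P' := P) (σ := σ.symm)
    (fun i => σ.injective (by simp [hstar])) (τ.symm : P'.T →+ P.T)
    (fun i => -τ.symm (e (σ.symm i))) (-τ.symm κ) (by
      intro i
      obtain ⟨i, rfl⟩ := σ.surjective i
      apply τ.injective
      have h1 := hdeg i
      rw [← hstar]
      simp only [AddMonoidHom.coe_coe, Equiv.symm_apply_apply, map_add, map_neg,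
        AddEquiv.apply_symm_apply]
      rw [← sub_eq_zero] at h1 ⊢
      rw [← neg_eq_zero, ← h1]
      abel)
  have hβα : ∀ i j t, β (P'.edeg (σ i) (σ j) t) =
      P.edeg i j (τ.symm (-e i + t + e j)) := by
    intro i j t
    rw [hβ]
    simp [sub_eq_add_neg]
  intro g hg
  obtain ⟨X₀, hX₀, hX₀'⟩ := (Submodule.ne_bot_iff _).1 hg
  have hβg : β (α g) = g := by
    obtain ⟨i, j, hij⟩ : ∃ i j, X₀ i j ≠ 0 := by
      by_contra! h
      exact hX₀' (Matrix.ext h)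
    obtain ⟨t, -, rfl⟩ := P.mem_comp_iff.1 hX₀ i j hij
    rw [hα, hβα]
    congr 1
    rw [AddEquiv.symm_apply_eq, AddMonoidHom.coe_coe]
    abel
  refine ⟨α g, le_antisymm ?_ ?_⟩
  · rintro _ ⟨X, hX, rfl⟩
    replace hX := P.mem_comp_iff.1 hX
    change monomialEquiv σ u ψ₀ X ∈ _
    rw [mem_comp_iff]
    intro i j hij
    obtain ⟨i, rfl⟩ := σ.surjective i
    obtain ⟨j, rfl⟩ := σ.surjective j
    rw [monomialEquiv_apply] at hij ⊢
    have h0 : X i j ≠ 0 := by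
      intro h
      simp [h] at hij
    obtain ⟨t, ht, rfl⟩ := hX i j h0
    refine ⟨e i + τ t - e j, ?_, (hα i j t).symm⟩
    rw [sub_eq_add_neg]
    exact P'.mul_mem_compD (P'.mul_mem_compD (he i) (hτ _ _ ht)) (P'.compD_inv (he j))
  · intro Y hY
    refine ⟨(monomialEquiv σ u ψ₀).symm Y, ?_, (monomialEquiv σ u ψ₀).apply_symm_apply Y⟩
    change _ ∈ P.comp g
    rw [mem_comp_iff] at hY ⊢
    intro i j hij
    rw [monomialEquiv_symm_apply] at hij ⊢
    have h0 : Y (σ i) (σ j) ≠ 0 := by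
      intro h
      simp [h] at hij
    obtain ⟨t, ht, htg⟩ := hY (σ i) (σ j) h0
    refine ⟨τ.symm (-e i + t + e j), hτ' _ _ ?_, ?_⟩
    · exact P'.mul_mem_compD (P'.mul_mem_compD (P'.compD_inv (he i)) ht) (he j)
    · rw [← hβα, htg, hβg]

theorem monomialEquiv_involution {σ : Idx P.q P.s ≃ Idx P'.q P'.s}
    (hstar : ∀ i, σ (star i) = star (σ i)) {u : Idx P.q P.s → Dˣ} {ψ₀ : D ≃ₐ[𝔽] D} {c₀ : Dˣ}
    (hinv : ∀ x : D, P'.φ₀ x = (c₀ : D) * ψ₀ (P.φ₀ (ψ₀.symm x)) * ((c₀⁻¹ : Dˣ) : D))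
    (hrel : ∀ i, c₀ * Units.map (ψ₀ : D →* D) (P.entry i) =
      P'.φ₀.mapUnit (u i) * P'.entry (σ i) * u (star i)) (X : P.Alg) :
    monomialEquiv σ u ψ₀ (P.involution X) = P'.involution (monomialEquiv σ u ψ₀ X) := by
  induction X using Matrix.induction_on' with
  | h_zero => simp
  | h_add X Y hX hY => simp only [map_add, hX, hY]
  | h_std_basis i j a =>
    rw [involution_single, monomialEquiv_single, monomialEquiv_single, involution_single,
      hstar, hstar]
    congr 1
    rw [intertwine_iff, ← hrel, ← hrel, mul_inv_cancel_right, mul_inv_cancel_right, hinv,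
      AlgEquiv.symm_apply_apply, mul_assoc, mul_assoc, Units.inv_mul, mul_one]

/-! ### Construction of an equivalence -/

theorem equivalent_of_data (hs : P'.s = P.s) {ψ₀ : D ≃ₐ[𝔽] D} (hψ : IsEquivalence 𝒟 𝒟 ψ₀)
    {c₀ : Dˣ} (hc₀ : c₀ ∈ homogeneousUnits 𝒟)
    (hinv : ∀ x : D, P'.φ₀ x = (c₀ : D) * ψ₀ (P.φ₀ (ψ₀.symm x)) * ((c₀⁻¹ : Dˣ) : D))
    (hsymm : P'.φ₀ (c₀ : D) = (P.δ * P'.δ) • (c₀ : D))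
    {c : Fin P.q → Dˣ} (hc : ∀ i, c i ∈ homogeneousUnits 𝒟) (π : Fin P'.q ≃ Fin P.q)
    (hd : ∀ i, P'.d i =
      (c₀ : D) * ψ₀ ((c (π i) : D) * P.d (π i) * P.φ₀ (c (π i) : D))) :
    EquivalentWithInvolution P.involution P'.involution := by
  have := IsGradedDivision.nontrivial (𝒟 := 𝒟)
  let σ : Idx P.q P.s ≃ Idx P'.q P'.s :=
    Equiv.sumCongr π.symm (Equiv.prodCongr (Equiv.refl _) (finCongr hs.symm))
  have hstar : ∀ i, σ (star i) = star (σ i) := by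
    rintro (i | ⟨a, i⟩) <;> rfl
  let u : Idx P.q P.s → Dˣ := Sum.elim
    (fun i => (Units.map (ψ₀ : D →* D) (P.φ₀.mapUnit (c i)))⁻¹)
    (fun x => if x.1 = 0 then 1 else c₀)
  have hu : ∀ i, u i ∈ homogeneousUnits 𝒟 := by
    rintro (i | ⟨a, i⟩)
    · exact inv_mem_homogeneousUnits (map_mem_homogeneousUnits hψ (mapUnit_mem _ (hc i)))
    · change (if a = 0 then 1 else c₀) ∈ _
      split_ifs
      · exact ⟨0, SetLike.one_mem_graded 𝒟⟩
      · exact hc₀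
  have hrel : ∀ i, c₀ * Units.map (ψ₀ : D →* D) (P.entry i) =
      P'.φ₀.mapUnit (u i) * P'.entry (σ i) * u (star i) := by
    rintro (i | ⟨a, i⟩)
    · have h1 : P'.φ₀.mapUnit (Units.map (ψ₀ : D →* D) (P.φ₀.mapUnit (c i))) =
          c₀ * Units.map (ψ₀ : D →* D) (c i) * c₀⁻¹ := by
        ext
        rw [GradedInvolution.coe_mapUnit, hinv]
        change (c₀ : D) * ψ₀ (P.φ₀ (ψ₀.symm (ψ₀ (P.φ₀ (c i : D))))) * _ = _
        rw [AlgEquiv.symm_apply_apply, P.φ₀.involutive']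
        rfl
      have h2 : P'.dUnit (π.symm i) = c₀ * (Units.map (ψ₀ : D →* D) (c i) *
          Units.map (ψ₀ : D →* D) (P.dUnit i) *
          Units.map (ψ₀ : D →* D) (P.φ₀.mapUnit (c i))) := by
        ext
        rw [coe_dUnit, hd, Equiv.apply_symm_apply, map_mul, map_mul]
        rfl
      have h3 : P'.φ₀.mapUnit (Units.map (ψ₀ : D →* D) (P.φ₀.mapUnit (c i)))⁻¹ =
          (P'.φ₀.mapUnit (Units.map (ψ₀ : D →* D) (P.φ₀.mapUnit (c i))))⁻¹ := rfl
      change c₀ * Units.map (ψ₀ : D →* D) (P.dUnit i) =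
        P'.φ₀.mapUnit (Units.map (ψ₀ : D →* D) (P.φ₀.mapUnit (c i)))⁻¹ * P'.dUnit (π.symm i) *
          (Units.map (ψ₀ : D →* D) (P.φ₀.mapUnit (c i)))⁻¹
      rw [h3, h1, h2]
      group
    · ext
      fin_cases a
      · simp [entry, u, σ, star, GradedInvolution.coe_mapUnit, GradedInvolution.map_one']
      · simp [entry, u, σ, star, GradedInvolution.coe_mapUnit, hsymm, δUnit,
          Algebra.algebraMap_eq_smul_one, smul_smul, mul_assoc, P'.δ_mul_δ, mul_comm P'.δ]
  exact ⟨monomialEquiv σ u ψ₀, monomialEquiv_isEquivalence hstar hu hψ hc₀ hrel,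
    monomialEquiv_involution hstar hinv hrel⟩

end Params

end GradedInv

theorem mainTheorem6 {𝔽 D G : Type*} [Field 𝔽] [Ring D] [Algebra 𝔽 D] [AddGroup G]
    [DecidableEq G] (𝒟 : G → Submodule 𝔽 D) [GradedAlgebra 𝒟] [GradedInv.IsGradedDivision 𝒟]
    (P P' : GradedInv.Params 𝒟) :
    GradedInv.EquivalentWithInvolution P.involution P'.involution ↔
      P'.q = P.q ∧ P'.s = P.s ∧
        ∃ ψ₀ : D ≃ₐ[𝔽] D, GradedInv.IsEquivalence 𝒟 𝒟 ψ₀ ∧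
          ∃ c₀ ∈ GradedInv.homogeneousUnits 𝒟,
            (∀ x : D, P'.φ₀ x = (c₀ : D) * ψ₀ (P.φ₀ (ψ₀.symm x)) * ((c₀⁻¹ : Dˣ) : D)) ∧
            P'.φ₀ (c₀ : D) = (P.δ * P'.δ) • (c₀ : D) ∧
            ∃ c : Fin P.q → Dˣ, (∀ i, c i ∈ GradedInv.homogeneousUnits 𝒟) ∧
              ∃ π : Fin P'.q ≃ Fin P.q, ∀ i,
                P'.d i =
                  (c₀ : D) * ψ₀ ((c (π i) : D) * P.d (π i) * P.φ₀ (c (π i) : D)) := by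
  refine ⟨GradedInv.Params.exists_data_of_equivalent, ?_⟩
  rintro ⟨-, hs, ψ₀, hψ, c₀, hc₀, hinv, hsymm, c, hc, π, hd⟩
  exact GradedInv.Params.equivalent_of_data hs hψ hc₀ hinv hsymm hc π hd
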